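/- **Notation.** Let $E$ be a finite set, $\mathcal F=\{0,1\}^E$, and let $P=\{x\in[0,1]^E: Ax\le b\}$ with $A$ a nonnegative real matrix with rows $A^1,\dots,A^m$ and $b$ a positive vector. Write $P_I=\operatorname{conv}(P\cap\{0,1\}^E)$ and $K(Q)=\{(\lambda,\lambda x):\lambda\ge 0,\ x\in Q\}$. For $S,T,U\subseteq E$ and an integer $r\ge 0$ put $S|_1=\{x\in\mathcal F:x_i=1\ \forall i\in S\}$, $T|_0=\{x\in\mathcal F:x_i=0\ \forall i\in T\}$ and $U|_{<r}=\{x\in\mathcal F:\sum_{i\in U}x_i\le r-1\}$; write $i|_t$ for $\{i\}|_t$. **The operator $\mathrm{BZ}_+'^k$, $k\ge 1$.** A set $O\subseteq E$ is a *$k$-small obstruction* if for some row $i$ we have $O\subseteq\operatorname{supp}(A^i)$, $\sum_{j\in O}A^i_j>b_i$, and $|O|\le k+1$ or $|O|\ge|\operatorname{supp}(A^i)|-(k+1)$. Let $\mathcal O_k(P)$ be the set of $x\in P$ with $\sum_{i\in O}x_i\le|O|-1$ for all $k$-small obstructions $O$. A *wall* is a singleton of $E$, or the set of all elements lying in at least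 two members of some set of at most $k+1$ $k$-small obstructions. A *tier* is a subset of a union of $k$ walls. Let $\mathcal A'$ consist of, for every tier $S$, the sets $(S\setminus T)|_1\cap T|_0$ with $T\subseteq S$, $|T|\le k$, and the sets $(S\setminus(T\cup U))|_1\cap T|_0\cap U|_{<|U|-(k-|T|)}$ with disjoint $T,U\subseteq S$, $|T|<k$, $|U|+|T|>k$. Then $\mathrm{BZ}_+'^k(P)$ is the set of all $x\in\mathbb R^E$ for which there is a symmetric positive semidefinite real matrix $Y$ indexed by $\mathcal A'\times\mathcal A'$ with $Y[i|_1,\mathcal F]=x_i$ for all $i\in E$ such that: 1. $Y[\mathcal F,\mathcal F]=1$. 2. Every column $y$ of $Y$ satisfies: - (i) $0\le y_\alpha\le y_{\mathcal F}$ for all $\alpha\in\mathcal A'$; - (ii) $(y_{\mathcal F},(y_{i|_1})_{i\in E})\in K(\mathcal O_k(P))$; - (iii) $y_{i|_1}+y_{i|_0}=y_{\mathcal F}$ for all $i\in E$; - (iv) for each $\alpha\in\mathcal A'$ of the form $S|_1\cap T|_0$ with $S,T$ disjoint: $y_{i|_1}\ge y_\alpha$ for $i\in S$; $y_{i|_0}\ge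 y_\alpha$ for $i\in T$; $y_\alpha+y_{(S\cup\{i\})|_1\cap(T\setminus\{i\})|_0}=y_{S|_1\cap(T\setminus\{i\})|_0}$ for $i\in T$; and $\sum_{i\in S}y_{i|_1}+\sum_{i\in T}y_{i|_0}-y_\alpha\le(|S|+|T|-1)y_{\mathcal F}$; - (v) for each $\alpha\in\mathcal A'$ of the form $S|_1\cap T|_0\cap U|_{<r}$ with $S,T,U$ pairwise disjoint: $y_{i|_1}\ge y_\alpha$ for $i\in S$; $y_{i|_0}\ge y_\alpha$ for $i\in T$; $\sum_{i\in U}y_{i|_0}\ge(|U|-(r-1))y_\alpha$; and $y_\alpha=y_{S|_1\cap T|_0}-\sum_{U'\subseteq U,\,|U'|\ge r}y_{(S\cup U')|_1\cap(T\cup(U\setminus U'))|_0}$. 3. $Y[\alpha,\beta]=0$ for all $\alpha,\beta\in\mathcal A'$ with $\operatorname{conv}(\alpha)\cap\operatorname{conv}(\beta)\cap P=\emptyset$. 4. $Y[\alpha_1,\beta_1]=Y[\alpha_2,\beta_2]$ for all $\alpha_1,\beta_1,\alpha_2,\beta_2\in\mathcal A'$ with $\alpha_1\cap\beta_1=\alpha_2\cap\beta_2$.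 Put $\mathrm{BZ}_+'^0(P)=P$. The *$\mathrm{BZ}'_+$-rank* of $P$ is the smallest integer $k\ge 0$ with $\mathrm{BZ}_+'^k(P)=P_I$. (The operator depends on the system $Ax\le b$, not only on $P$.) For a simple graph $G=(V,E)$ let $MT(G)=\{x\in[0,1]^E:\sum_{e\ni v}x_e\le 1\ \ \forall v\in V\}$, described by this system of vertex inequalities. **Theorem.** For every integer $n\ge 0$, the $\mathrm{BZ}'_+$-rank of $MT(K_{2n+1})$ is at most $\left\lceil\sqrt{2n+\tfrac14}-\tfrac12\right\rceil$. -/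

import Mathlib

namespace LiftProject

section Operator

variable {ι m : Type*}

/-- The vertex set `{0,1}^ι` of the unit cube, denoted `F` below. -/
def cube (ι : Type*) : Set (ι → ℝ) := {x | ∀ i, x i = 0 ∨ x i = 1}

/-- The integer hull `P_I`: the convex hull of the 0-1 points of `P`. -/
def integerHull (P : Set (ι → ℝ)) : Set (ι → ℝ) := convexHull ℝ (P ∩ cube ι)

/-- The cone `K(P)` of all `(t, t x)` with `t ≥ 0` and `x ∈ P`. -/
def cone (P : Set (ι → ℝ)) : Set (ℝ × (ι → ℝ)) :=
  {p | ∃ t : ℝ, 0 ≤ t ∧ ∃ x ∈ P, p = (t, t • x)}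

/-- `S|₁`: the 0-1 points equal to one on `S`. -/
def onOne (S : Finset ι) : Set (ι → ℝ) := {x ∈ cube ι | ∀ i ∈ S, x i = 1}

/-- `S|₀`: the 0-1 points equal to zero on `S`. -/
def onZero (S : Finset ι) : Set (ι → ℝ) := {x ∈ cube ι | ∀ i ∈ S, x i = 0}

/-- `U|_{<r}`: the 0-1 points whose coordinates in `U` sum to at most `r - 1`. -/
def below (U : Finset ι) (r : ℕ) : Set (ι → ℝ) := {x ∈ cube ι | ∑ i ∈ U, x i ≤ (r : ℝ) - 1}

variable [Fintype ι]

/-- The polytope `{x ∈ [0,1]^ι : A x ≤ b}`. -/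
def polytope (A : Matrix m ι ℝ) (b : m → ℝ) : Set (ι → ℝ) :=
  {x | (∀ i, 0 ≤ x i ∧ x i ≤ 1) ∧ ∀ j, ∑ i, A j i * x i ≤ b j}

/-- The support of row `j` of `A`. -/
noncomputable def rowSupport (A : Matrix m ι ℝ) (j : m) : Finset ι :=
  {i ∈ (Finset.univ : Finset ι) | A j i ≠ 0}

/-- `O` is a `k`-small obstruction of the system `A x ≤ b`. The last inequality is
`|O| ≥ |supp| - (k + 1)`. -/
def IsObstruction (A : Matrix m ι ℝ) (b : m → ℝ) (k : ℕ) (O : Finset ι) : Prop :=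
  ∃ j, O ⊆ rowSupport A j ∧ b j < ∑ i ∈ O, A j i ∧
    (O.card ≤ k + 1 ∨ (rowSupport A j).card ≤ O.card + (k + 1))

/-- The refinement `O_k(P)`. -/
def refinement (A : Matrix m ι ℝ) (b : m → ℝ) (k : ℕ) : Set (ι → ℝ) :=
  {x ∈ polytope A b | ∀ O, IsObstruction A b k O → ∑ i ∈ O, x i ≤ (O.card : ℝ) - 1}

/-- `W` is a wall: either a singleton, or the set of all elements that lie in at least two members
of a set of at most `k + 1` obstructions. -/
def IsWall (A : Matrix m ι ℝ) (b : m → ℝ) (k : ℕ) (W : Finset ι) : Prop :=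
  (∃ i, W = {i}) ∨
    ∃ C : Finset (Finset ι), C.card ≤ k + 1 ∧ (∀ O ∈ C, IsObstruction A b k O) ∧
      ∀ i, i ∈ W ↔ ∃ O ∈ C, ∃ O' ∈ C, O ≠ O' ∧ i ∈ O ∧ i ∈ O'

/-- `S` is a tier: it is contained in the union of `k` walls. -/
def IsTier (A : Matrix m ι ℝ) (b : m → ℝ) (k : ℕ) (S : Finset ι) : Prop :=
  ∃ W : Fin k → Finset ι, (∀ j, IsWall A b k (W j)) ∧ ∀ i ∈ S, ∃ j, i ∈ W j

variable [DecidableEq ι]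

/-- The index set `A'` of the lifted matrices. -/
def indexSet (A : Matrix m ι ℝ) (b : m → ℝ) (k : ℕ) : Set (Set (ι → ℝ)) :=
  {α | ∃ S, IsTier A b k S ∧
    ((∃ T, T ⊆ S ∧ T.card ≤ k ∧ α = onOne (S \ T) ∩ onZero T) ∨
      ∃ T U, T ⊆ S ∧ U ⊆ S ∧ Disjoint U T ∧ T.card < k ∧ k < U.card + T.card ∧
        α = onOne (S \ (T ∪ U)) ∩ onZero T ∩ below U (U.card - (k - T.card)))}

/-- The conditions imposed on each single column `y` of a lifted matrix. -/
structure ColumnOK (A : Matrix m ι ℝ) (b : m → ℝ) (k : ℕ) (y : Set (ι → ℝ) → ℝ) : Prop where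
  bounds : ∀ α ∈ indexSet A b k, 0 ≤ y α ∧ y α ≤ y (cube ι)
  mem_cone : (y (cube ι), fun i => y (onOne {i})) ∈ cone (refinement A b k)
  compl : ∀ i, y (onOne {i}) + y (onZero {i}) = y (cube ι)
  cyl_one : ∀ S T, Disjoint S T → onOne S ∩ onZero T ∈ indexSet A b k →
    ∀ i ∈ S, y (onOne S ∩ onZero T) ≤ y (onOne {i})
  cyl_zero : ∀ S T, Disjoint S T → onOne S ∩ onZero T ∈ indexSet A b k →
    ∀ i ∈ T, y (onOne S ∩ onZero T) ≤ y (onZero {i})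
  cyl_split : ∀ S T, Disjoint S T → onOne S ∩ onZero T ∈ indexSet A b k →
    ∀ i ∈ T, y (onOne S ∩ onZero T) + y (onOne (S ∪ {i}) ∩ onZero (T \ {i}))
      = y (onOne S ∩ onZero (T \ {i}))
  cyl_sum : ∀ S T, Disjoint S T → onOne S ∩ onZero T ∈ indexSet A b k →
    ∑ i ∈ S, y (onOne {i}) + ∑ i ∈ T, y (onZero {i}) - y (onOne S ∩ onZero T)
      ≤ ((S.card : ℝ) + T.card - 1) * y (cube ι)
  low_one : ∀ S T U r, Disjoint S T → Disjoint S U → Disjoint T U →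
    onOne S ∩ onZero T ∩ below U r ∈ indexSet A b k →
    ∀ i ∈ S, y (onOne S ∩ onZero T ∩ below U r) ≤ y (onOne {i})
  low_zero : ∀ S T U r, Disjoint S T → Disjoint S U → Disjoint T U →
    onOne S ∩ onZero T ∩ below U r ∈ indexSet A b k →
    ∀ i ∈ T, y (onOne S ∩ onZero T ∩ below U r) ≤ y (onZero {i})
  low_sum : ∀ S T U r, Disjoint S T → Disjoint S U → Disjoint T U →
    onOne S ∩ onZero T ∩ below U r ∈ indexSet A b k →
    ((U.card : ℝ) - ((r : ℝ) - 1)) * y (onOne S ∩ onZero T ∩ below U r) ≤ ∑ i ∈ U, y (onZero {i})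
  low_split : ∀ S T U r, Disjoint S T → Disjoint S U → Disjoint T U →
    onOne S ∩ onZero T ∩ below U r ∈ indexSet A b k →
    y (onOne S ∩ onZero T ∩ below U r) = y (onOne S ∩ onZero T)
      - ∑ U' ∈ U.powerset with r ≤ U'.card, y (onOne (S ∪ U') ∩ onZero (T ∪ (U \ U')))

/-- The lifted set of certificate matrices. A matrix indexed by `A'` is written as a function `Y` of
two subsets of `F`; only its values on `A'` matter, because for `k ≥ 1` every set that is mentioned
in a condition below belongs to `A'`. -/
structure IsCertificate (A : Matrix m ι ℝ) (b : m → ℝ) (k : ℕ)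
    (Y : Set (ι → ℝ) → Set (ι → ℝ) → ℝ) : Prop where
  normalized : Y (cube ι) (cube ι) = 1
  symmetric : ∀ α ∈ indexSet A b k, ∀ β ∈ indexSet A b k, Y α β = Y β α
  columns : ∀ β ∈ indexSet A b k, ColumnOK A b k (fun α => Y α β)
  vanishing : ∀ α ∈ indexSet A b k, ∀ β ∈ indexSet A b k,
    convexHull ℝ α ∩ convexHull ℝ β ∩ polytope A b = ∅ → Y α β = 0
  consistent : ∀ α₁ ∈ indexSet A b k, ∀ β₁ ∈ indexSet A b k,
    ∀ α₂ ∈ indexSet A b k, ∀ β₂ ∈ indexSet A b k,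
      α₁ ∩ β₁ = α₂ ∩ β₂ → Y α₁ β₁ = Y α₂ β₂

/-- The relaxation obtained from `{x ∈ [0,1]^ι : A x ≤ b}` by the `k`-th level of the
semidefinite operator; level `0` is the polytope itself. -/
def bzPlus (A : Matrix m ι ℝ) (b : m → ℝ) (k : ℕ) : Set (ι → ℝ) :=
  if k = 0 then polytope A b else
    {x | ∃ Y : Set (ι → ℝ) → Set (ι → ℝ) → ℝ, IsCertificate A b k Y ∧
      (Matrix.of fun α β : indexSet A b k => Y α β).PosSemidef ∧
      ∀ i, Y (onOne {i}) (cube ι) = x i}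

/-- The rank: the least `k` at which the integer hull is attained, `⊤` if there is none. -/
noncomputable def bzPlusRank (A : Matrix m ι ℝ) (b : m → ℝ) : ℕ∞ :=
  ⨅ (k : ℕ) (_ : bzPlus A b k = integerHull (polytope A b)), (k : ℕ∞)

end Operator

section Matching

variable {V : Type*} [DecidableEq V] (G : SimpleGraph V)

/-- The polytope `MT(G)`: the points of `[0,1]^E` whose sum over the edges at any vertex is at
most one. -/
def MT [Fintype G.edgeSet] : Set (G.edgeSet → ℝ) :=
  {x | (∀ e, 0 ≤ x e ∧ x e ≤ 1) ∧ ∀ v, ∑ e : G.edgeSet, (if v ∈ (e : Sym2 V) then x e else 0) ≤ 1}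

/-- The vertex-edge incidence matrix of `G`, the matrix of the system that defines `MT(G)`. -/
def incidence : Matrix V G.edgeSet ℝ := fun v e => if v ∈ (e : Sym2 V) then 1 else 0

theorem polytope_incidence [Fintype G.edgeSet] : polytope (incidence G) (fun _ => 1) = MT G := by
  ext x
  simp [polytope, MT, incidence]

end Matching

end LiftProject

/-! The lower inclusion holds for every nonnegative system: a feasible 0-1 point is certified by the
rank-one matrix of its Dirac measure, and each level is convex.

For the upper inclusion, the star of a vertex of degree at least two is an obstruction at every
level `k`. An edge lies in the stars of its two ends, so `k + 1` stars give a wall containing any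
prescribed `(k + 1) / 2` edges, and `k` walls make every set of at most `L = k * ((k + 1) / 2)`
edges a tier (`isTier_of_card_le`). The certificate therefore contains a moment matrix on edge sets
of size up to `L`. By Möbius inversion it comes from a signed measure, which the vanishing condition
confines to matchings and whose expectation is nonnegative on squares of polynomials of degree at
most `L` (`exists_pseudoDistribution`).

Let `W` be an odd vertex set, `|W| = 2 r + 1`, and push the measure forward to the number of
matching edges inside `W`, which is at most `r`. A univariate functional nonnegative on squares of
degree `L` polynomials is nonnegative on all nonnegative polynomials of degree `2 L`. A translate of
`gapPoly (2 * L - 1)` is such a polynomial and equals `r - j` at `j = 0, ..., r` as long as `r < 2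
L`; its expectation yields the odd set inequality (`sum_le_of_mem_bzPlus`).

Degree and odd set inequalities describe the matching polytope (`mem_integerHull_MT`). This is
proved in weighted form by induction on integral weights (`exists_involution_weight_ge`). For `n >
0` the level in the theorem satisfies `2 n ≤ k (k + 1)`, which forces `n < 2 L`. -/

namespace LiftProject

/-! ### Dirac measures and rank-one matrices -/

section PointMass

open Classical in
/-- The Dirac measure at `x`, as a function of sets. -/
noncomputable def pointMass {X : Type*} (x : X) (α : Set X) : ℝ := if x ∈ α then 1 else 0

theorem pointMass_of_mem {X : Type*} {x : X} {α : Set X} (h : x ∈ α) : pointMass x α = 1 := if_pos h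

theorem pointMass_of_notMem {X : Type*} {x : X} {α : Set X} (h : x ∉ α) : pointMass x α = 0 :=
  if_neg h

theorem pointMass_nonneg {X : Type*} (x : X) (α : Set X) : 0 ≤ pointMass x α := by
  unfold pointMass
  split_ifs <;> simp

theorem pointMass_le {X : Type*} {x : X} {α : Set X} {c : ℝ} (h0 : 0 ≤ c) (h1 : x ∈ α → 1 ≤ c) :
    pointMass x α ≤ c := by
  unfold pointMass
  split_ifs with h
  exacts [h1 h, h0]

theorem pointMass_mul {X : Type*} (x : X) (α β : Set X) :
    pointMass x α * pointMass x β = pointMass x (α ∩ β) := by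
  by_cases h : x ∈ α <;> by_cases h' : x ∈ β <;> simp [pointMass, h, h']

theorem posSemidef_of_mul {n : Type*} (a : n → ℝ) :
    (Matrix.of fun i j => a i * a j).PosSemidef := by
  refine ⟨Matrix.IsHermitian.ext fun i j => by simp [mul_comm], fun x => ?_⟩
  have : (x.sum fun i xi => x.sum fun j xj => star xi * (Matrix.of fun i j => a i * a j) i j * xj)
      = (x.sum fun i xi => a i * xi) * (x.sum fun i xi => a i * xi) := by
    simp only [Finsupp.sum, Finset.sum_mul_sum, Matrix.of_apply, star_trivial]
    exact Finset.sum_congr rfl fun i _ => Finset.sum_congr rfl fun j _ => by ring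
  rw [this]
  exact mul_self_nonneg _

end PointMass

/-! ### Every level contains the integer hull -/

section IntegerHull

variable {ι m : Type*} [Fintype ι] 

theorem polytope_convex (A : Matrix m ι ℝ) (b : m → ℝ) : Convex ℝ (polytope A b) := by
  intro x hx y hy s t hs ht hst
  refine ⟨fun i => ?_, fun j => ?_⟩
  · have h1 := hx.1 i
    have h2 := hy.1 i
    simp only [Pi.add_apply, Pi.smul_apply, smul_eq_mul]
    constructor <;> nlinarith
  · have h1 := hx.2 j
    have h2 := hy.2 j
    have e : ∑ i, A j i * (s • x + t • y) i = s * ∑ i, A j i * x i + t * ∑ i, A j i * y i := by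
      rw [Finset.mul_sum, Finset.mul_sum, ← Finset.sum_add_distrib]
      refine Finset.sum_congr rfl fun i _ => ?_
      simp only [Pi.add_apply, Pi.smul_apply, smul_eq_mul]
      ring
    rw [e]
    calc _ ≤ s * b j + t * b j := add_le_add (mul_le_mul_of_nonneg_left h1 hs)
          (mul_le_mul_of_nonneg_left h2 ht)
      _ = b j := by rw [← add_mul, hst, one_mul]

theorem refinement_convex (A : Matrix m ι ℝ) (b : m → ℝ) (k : ℕ) :
    Convex ℝ (refinement A b k) := by
  intro x hx y hy s t hs ht hst
  refine ⟨polytope_convex A b hx.1 hy.1 hs ht hst, fun O hO => ?_⟩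
  have h1 := hx.2 O hO
  have h2 := hy.2 O hO
  simp only [Pi.add_apply, Pi.smul_apply, smul_eq_mul, Finset.sum_add_distrib, ← Finset.mul_sum]
  nlinarith

omit [Fintype ι] in
theorem smul_mem_cone {P : Set (ι → ℝ)} {p : ℝ × (ι → ℝ)} (hp : p ∈ cone P) {s : ℝ} (hs : 0 ≤ s) :
    s • p ∈ cone P := by
  obtain ⟨t, ht, x, hx, rfl⟩ := hp
  exact ⟨s * t, mul_nonneg hs ht, x, hx, by simp [mul_smul]⟩

omit [Fintype ι] in
theorem add_mem_cone {P : Set (ι → ℝ)} (hP : Convex ℝ P) {p q : ℝ × (ι → ℝ)} (hp : p ∈ cone P)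
    (hq : q ∈ cone P) : p + q ∈ cone P := by
  obtain ⟨s, hs, x, hx, rfl⟩ := hp
  obtain ⟨t, ht, y, hy, rfl⟩ := hq
  rcases (add_nonneg hs ht).eq_or_lt with h | h
  · have h1 : s = 0 := by linarith
    have h2 : t = 0 := by linarith
    exact ⟨0, le_rfl, x, hx, by simp [h1, h2]⟩
  · refine ⟨s + t, h.le, (s / (s + t)) • x + (t / (s + t)) • y,
      hP hx hy (by positivity) (by positivity) (by field_simp), ?_⟩
    simp only [smul_add, smul_smul, mul_div_cancel₀ _ h.ne', Prod.mk_add_mk]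

variable [DecidableEq ι]

/-- The column conditions are homogeneous linear relations together with membership in a cone over a
convex set; this is the source of the convexity of each level. -/
theorem ColumnOK.combination {A : Matrix m ι ℝ} {b : m → ℝ} {k : ℕ} {y z : Set (ι → ℝ) → ℝ}
    (hy : ColumnOK A b k y) (hz : ColumnOK A b k z) {s t : ℝ} (hs : 0 ≤ s) (ht : 0 ≤ t) :
    ColumnOK A b k (fun α => s * y α + t * z α) where
  bounds α hα := by
    have h1 := hy.bounds α hα
    have h2 := hz.bounds α hα
    exact ⟨add_nonneg (mul_nonneg hs h1.1) (mul_nonneg ht h2.1),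
      add_le_add (mul_le_mul_of_nonneg_left h1.2 hs) (mul_le_mul_of_nonneg_left h2.2 ht)⟩
  mem_cone := add_mem_cone (refinement_convex A b k) (smul_mem_cone hy.mem_cone hs)
    (smul_mem_cone hz.mem_cone ht)
  compl i := by linear_combination s * hy.compl i + t * hz.compl i
  cyl_one S T h hα i hi := add_le_add (mul_le_mul_of_nonneg_left (hy.cyl_one S T h hα i hi) hs)
    (mul_le_mul_of_nonneg_left (hz.cyl_one S T h hα i hi) ht)
  cyl_zero S T h hα i hi := add_le_add (mul_le_mul_of_nonneg_left (hy.cyl_zero S T h hα i hi) hs)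
    (mul_le_mul_of_nonneg_left (hz.cyl_zero S T h hα i hi) ht)
  cyl_split S T h hα i hi := by
    linear_combination s * hy.cyl_split S T h hα i hi + t * hz.cyl_split S T h hα i hi
  cyl_sum S T h hα := by
    have h1 := mul_le_mul_of_nonneg_left (hy.cyl_sum S T h hα) hs
    have h2 := mul_le_mul_of_nonneg_left (hz.cyl_sum S T h hα) ht
    simp only [Finset.sum_add_distrib, ← Finset.mul_sum]
    linarith
  low_one S T U r h h' h'' hα i hi :=
    add_le_add (mul_le_mul_of_nonneg_left (hy.low_one S T U r h h' h'' hα i hi) hs)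
      (mul_le_mul_of_nonneg_left (hz.low_one S T U r h h' h'' hα i hi) ht)
  low_zero S T U r h h' h'' hα i hi :=
    add_le_add (mul_le_mul_of_nonneg_left (hy.low_zero S T U r h h' h'' hα i hi) hs)
      (mul_le_mul_of_nonneg_left (hz.low_zero S T U r h h' h'' hα i hi) ht)
  low_sum S T U r h h' h'' hα := by
    have h1 := mul_le_mul_of_nonneg_left (hy.low_sum S T U r h h' h'' hα) hs
    have h2 := mul_le_mul_of_nonneg_left (hz.low_sum S T U r h h' h'' hα) ht
    simp only [Finset.sum_add_distrib, ← Finset.mul_sum]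
    linarith
  low_split S T U r h h' h'' hα := by
    simp only [Finset.sum_add_distrib, ← Finset.mul_sum]
    linear_combination s * hy.low_split S T U r h h' h'' hα + t * hz.low_split S T U r h h' h'' hα

/-- Serves the columns of a rank-one certificate indexed by sets that miss the point. Nonemptiness
puts the origin into the cone. -/
theorem ColumnOK.zero {A : Matrix m ι ℝ} {b : m → ℝ} {k : ℕ} (hP : (refinement A b k).Nonempty) :
    ColumnOK A b k (fun _ => 0) where
  bounds _ _ := ⟨le_rfl, le_rfl⟩
  mem_cone := by
    obtain ⟨x, hx⟩ := hP
    exact ⟨0, le_rfl, x, hx, by ext <;> simp⟩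
  compl _ := by simp
  cyl_one _ _ _ _ _ _ := le_rfl
  cyl_zero _ _ _ _ _ _ := le_rfl
  cyl_split _ _ _ _ _ _ := by simp
  cyl_sum _ _ _ _ := by simp
  low_one _ _ _ _ _ _ _ _ _ _ := le_rfl
  low_zero _ _ _ _ _ _ _ _ _ _ := le_rfl
  low_sum _ _ _ _ _ _ _ _ := by simp
  low_split _ _ _ _ _ _ _ _ := by simp

omit [DecidableEq ι] in
/-- Every 0-1 point of the polytope satisfies the obstruction inequalities. -/
theorem mem_refinement_of_mem_cube {A : Matrix m ι ℝ} (hA : ∀ j i, 0 ≤ A j i) {b : m → ℝ} (k : ℕ)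
    {x : ι → ℝ} (hx : x ∈ polytope A b) (hc : x ∈ cube ι) : x ∈ refinement A b k := by
  refine ⟨hx, fun O hO => ?_⟩
  obtain ⟨j, -, hlt, -⟩ := hO
  -- If `x` were one on all of `O`, the entries on `O` alone would exceed `b j`, and the remaining
  -- terms are nonnegative.
  have hne : ∃ i ∈ O, x i = 0 := by
    by_contra! h
    have h1 : ∀ i ∈ O, x i = 1 := fun i hi => (hc i).resolve_left (h i hi)
    have h2 : ∑ i ∈ O, A j i ≤ ∑ i, A j i * x i := by
      calc ∑ i ∈ O, A j i = ∑ i ∈ O, A j i * x i :=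
            Finset.sum_congr rfl fun i hi => by rw [h1 i hi, mul_one]
        _ ≤ _ := Finset.sum_le_univ_sum_of_nonneg fun i => mul_nonneg (hA j i) (hx.1 i).1
    linarith [hx.2 j]
  obtain ⟨i, hi, h0⟩ := hne
  classical
  rw [← Finset.add_sum_erase _ _ hi, h0, zero_add]
  have h1 : ∑ i ∈ O.erase i, x i ≤ ∑ i ∈ O.erase i, (1 : ℝ) :=
    Finset.sum_le_sum fun i _ => (hx.1 i).2
  have h2 := Finset.card_erase_add_one hi
  rw [Finset.sum_const, nsmul_one] at h1
  have h3 : ((O.erase i).card : ℝ) + 1 = O.card := by exact_mod_cast h2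
  linarith

/-- The column of a 0-1 point of the polytope. -/
theorem ColumnOK.indicator {A : Matrix m ι ℝ} (hA : ∀ j i, 0 ≤ A j i) {b : m → ℝ} {k : ℕ}
    {x : ι → ℝ} (hx : x ∈ polytope A b) (hc : x ∈ cube ι) :
    ColumnOK A b k (pointMass x) := by
  have one : ∀ i, pointMass x (onOne {i}) = x i := fun i => by
    rcases hc i with h | h <;> simp [pointMass, onOne, hc, h]
  have zero : ∀ i, pointMass x (onZero {i}) = 1 - x i := fun i => by
    rcases hc i with h | h <;> simp [pointMass, onZero, hc, h]
  have hx0 : ∀ i, 0 ≤ x i := fun i => (hx.1 i).1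
  have hx1 : ∀ i, 0 ≤ 1 - x i := fun i => sub_nonneg.mpr (hx.1 i).2
  have hone : pointMass x (cube ι) = 1 := pointMass_of_mem hc
  constructor
  · intro α _
    rw [hone]
    exact ⟨pointMass_nonneg x α, pointMass_le zero_le_one fun _ => le_rfl⟩
  · refine ⟨1, zero_le_one, x, mem_refinement_of_mem_cube hA k hx hc, ?_⟩
    simp only [one, hone, one_smul]
  · intro i
    simp only [one, zero, hone]
    ring
  · intro S T _ _ i hi
    simp only [one]
    exact pointMass_le (hx0 i) fun h => (h.1.2 i hi).ge
  · intro S T _ _ i hi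
    simp only [zero]
    exact pointMass_le (hx1 i) fun h => by rw [h.2.2 i hi, sub_zero]
  · intro S T hST _ i hi
    have e1 : x ∈ onOne S ∩ onZero T ↔ x ∈ onOne S ∩ onZero (T \ {i}) ∧ x i = 0 := by
      constructor
      · intro h
        exact ⟨⟨h.1, hc, fun j hj => h.2.2 j (Finset.sdiff_subset hj)⟩, h.2.2 i hi⟩
      · intro h
        refine ⟨h.1.1, hc, fun j hj => ?_⟩
        by_cases e : j = i
        · rw [e, h.2]
        · exact h.1.2.2 j (by simp [hj, e])
    have e2 : x ∈ onOne (S ∪ {i}) ∩ onZero (T \ {i}) ↔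
        x ∈ onOne S ∩ onZero (T \ {i}) ∧ x i = 1 := by
      constructor
      · intro h
        exact ⟨⟨⟨hc, fun j hj => h.1.2 j (Finset.mem_union_left _ hj)⟩, h.2⟩, h.1.2 i (by simp)⟩
      · intro h
        refine ⟨⟨hc, fun j hj => ?_⟩, h.1.2⟩
        rcases Finset.mem_union.mp hj with e | e
        · exact h.1.1.2 j e
        · rw [Finset.mem_singleton.mp e, h.2]
    by_cases h : x ∈ onOne S ∩ onZero (T \ {i})
    · rw [pointMass_of_mem h]
      rcases hc i with h' | h'
      · rw [pointMass_of_mem (e1.mpr ⟨h, h'⟩), pointMass_of_notMem, add_zero]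
        rw [e2, h']
        simp
      · rw [pointMass_of_mem (e2.mpr ⟨h, h'⟩), pointMass_of_notMem, zero_add]
        rw [e1, h']
        simp
    · rw [pointMass_of_notMem h, pointMass_of_notMem fun e => h (e1.mp e).1,
        pointMass_of_notMem fun e => h (e2.mp e).1, add_zero]
  · intro S T _ _
    simp only [one, zero, hone]
    have h1 : ∑ i ∈ S, x i = S.card - ∑ i ∈ S, (1 - x i) := by simp
    have h2 : ∑ i ∈ T, (1 - x i) = T.card - ∑ i ∈ T, x i := by simp
    have h3 : 0 ≤ ∑ i ∈ S, (1 - x i) := Finset.sum_nonneg fun i _ => hx1 i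
    have h4 : 0 ≤ ∑ i ∈ T, x i := Finset.sum_nonneg fun i _ => hx0 i
    by_cases h : x ∈ onOne S ∩ onZero T
    · rw [pointMass_of_mem h]
      linarith
    · rw [pointMass_of_notMem h]
      have : (∃ i ∈ S, x i = 0) ∨ ∃ i ∈ T, x i = 1 := by
        by_contra! hcon
        exact h ⟨⟨hc, fun i hi => (hc i).resolve_left (hcon.1 i hi)⟩,
          hc, fun i hi => (hc i).resolve_right (hcon.2 i hi)⟩
      rcases this with ⟨i, hi, hxi⟩ | ⟨i, hi, hxi⟩
      · have := Finset.single_le_sum (f := fun i => 1 - x i) (fun i _ => hx1 i) hi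
        simp only [hxi] at this
        linarith
      · have := Finset.single_le_sum (f := fun i => x i) (fun i _ => hx0 i) hi
        simp only [hxi] at this
        linarith
  · intro S T U r _ _ _ _ i hi
    simp only [one]
    exact pointMass_le (hx0 i) fun h => (h.1.1.2 i hi).ge
  · intro S T U r _ _ _ _ i hi
    simp only [zero]
    exact pointMass_le (hx1 i) fun h => by rw [h.1.2.2 i hi, sub_zero]
  · intro S T U r _ _ _ _
    simp only [zero]
    have h1 : ∑ i ∈ U, (1 - x i) = U.card - ∑ i ∈ U, x i := by simp
    have h2 : 0 ≤ ∑ i ∈ U, (1 - x i) := Finset.sum_nonneg fun i _ => hx1 i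
    by_cases h : x ∈ onOne S ∩ onZero T ∩ below U r
    · rw [pointMass_of_mem h]
      have := h.2.2
      linarith
    · rw [pointMass_of_notMem h]
      linarith
  · intro S T U r _ _ _ _
    -- `V` is the pattern of `x` on `U`, so only `U' = V` can contribute to the subtracted sum.
    set V := U.filter fun i => x i = 1 with hV
    have hsum : ∑ i ∈ U, x i = V.card := by
      rw [hV, Finset.card_filter, Nat.cast_sum]
      refine Finset.sum_congr rfl fun i _ => ?_
      rcases hc i with h | h <;> simp [h]
    have hbelow : x ∈ below U r ↔ ¬ r ≤ V.card := by
      simp only [below, Set.mem_ofPred_eq, hc, true_and, hsum, not_le]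
      rw [le_sub_iff_add_le]
      exact_mod_cast Iff.rfl
    have hmem : ∀ U' ∈ U.powerset, (x ∈ onOne (S ∪ U') ∩ onZero (T ∪ (U \ U')) ↔
        x ∈ onOne S ∩ onZero T ∧ U' = V) := by
      intro U' hU'
      rw [Finset.mem_powerset] at hU'
      constructor
      · intro h
        refine ⟨⟨⟨hc, fun j hj => h.1.2 j (Finset.mem_union_left _ hj)⟩,
          hc, fun j hj => h.2.2 j (Finset.mem_union_left _ hj)⟩, ?_⟩
        ext j
        rw [hV, Finset.mem_filter]
        refine ⟨fun hj => ⟨hU' hj, h.1.2 j (Finset.mem_union_right _ hj)⟩, fun hj => ?_⟩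
        by_contra hn
        have := h.2.2 j (Finset.mem_union_right _ (Finset.mem_sdiff.mpr ⟨hj.1, hn⟩))
        rw [hj.2] at this
        exact one_ne_zero this
      · rintro ⟨h, rfl⟩
        refine ⟨⟨hc, fun j hj => ?_⟩, hc, fun j hj => ?_⟩
        · rcases Finset.mem_union.mp hj with e | e
          · exact h.1.2 j e
          · exact (Finset.mem_filter.mp e).2
        · rcases Finset.mem_union.mp hj with e | e
          · exact h.2.2 j e
          · rw [Finset.mem_sdiff, hV, Finset.mem_filter, not_and] at e
            exact (hc j).resolve_right (e.2 e.1)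
    have hs : ∑ U' ∈ U.powerset with r ≤ U'.card, pointMass x (onOne (S ∪ U') ∩ onZero (T ∪ (U \ U')))
        = if r ≤ V.card then pointMass x (onOne S ∩ onZero T) else 0 := by
      rw [Finset.sum_filter]
      have : ∀ U' ∈ U.powerset, (if r ≤ U'.card then
          pointMass x (onOne (S ∪ U') ∩ onZero (T ∪ (U \ U'))) else 0)
          = if U' = V then (if r ≤ V.card then pointMass x (onOne S ∩ onZero T) else 0) else 0 := by
        intro U' hU'
        by_cases h : U' = V
        · rw [if_pos h, ← h]
          congr 1
          by_cases h' : x ∈ onOne S ∩ onZero T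
          · rw [pointMass_of_mem h', pointMass_of_mem ((hmem U' hU').mpr ⟨h', h⟩)]
          · rw [pointMass_of_notMem h', pointMass_of_notMem fun e => h' ((hmem U' hU').mp e).1]
        · rw [if_neg h, pointMass_of_notMem fun e => h ((hmem U' hU').mp e).2, ite_self]
      rw [Finset.sum_congr rfl this, Finset.sum_ite_eq', if_pos]
      exact Finset.mem_powerset.mpr (Finset.filter_subset _ _)
    rw [hs]
    by_cases h1 : x ∈ onOne S ∩ onZero T
    · by_cases h2 : r ≤ V.card
      · rw [pointMass_of_notMem fun e => hbelow.mp e.2 h2, if_pos h2, sub_self]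
      · have h3 : x ∈ onOne S ∩ onZero T ∩ below U r := ⟨h1, hbelow.mpr h2⟩
        rw [pointMass_of_mem h3, pointMass_of_mem h1, if_neg h2, sub_zero]
    · rw [pointMass_of_notMem fun e => h1 e.1, pointMass_of_notMem h1, ite_self, sub_zero]

theorem bzPlus_convex (A : Matrix m ι ℝ) (b : m → ℝ) (k : ℕ) : Convex ℝ (bzPlus A b k) := by
  rw [bzPlus]
  split_ifs with hk
  · exact polytope_convex A b
  rintro x ⟨Y, hY, hYp, hYx⟩ y ⟨Z, hZ, hZp, hZx⟩ s t hs ht hst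
  refine ⟨fun α β => s * Y α β + t * Z α β, ?_, ?_, fun i => ?_⟩
  · constructor
    · rw [hY.normalized, hZ.normalized]
      linarith
    · intro α hα β hβ
      rw [hY.symmetric α hα β hβ, hZ.symmetric α hα β hβ]
    · intro β hβ
      exact (hY.columns β hβ).combination (hZ.columns β hβ) hs ht
    · intro α hα β hβ h
      rw [hY.vanishing α hα β hβ h, hZ.vanishing α hα β hβ h]
      simp
    · intro α₁ h₁ β₁ h₂ α₂ h₃ β₂ h₄ h
      rw [hY.consistent α₁ h₁ β₁ h₂ α₂ h₃ β₂ h₄ h, hZ.consistent α₁ h₁ β₁ h₂ α₂ h₃ β₂ h₄ h]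
  · exact (hYp.smul hs).add (hZp.smul ht)
  · simp [hYx, hZx]

theorem mem_bzPlus_of_mem_cube {A : Matrix m ι ℝ} (hA : ∀ j i, 0 ≤ A j i) {b : m → ℝ} (k : ℕ)
    {x : ι → ℝ} (hx : x ∈ polytope A b) (hc : x ∈ cube ι) : x ∈ bzPlus A b k := by
  rw [bzPlus]
  split_ifs with hk
  · exact hx
  refine ⟨fun α β => pointMass x α * pointMass x β, ?_, posSemidef_of_mul _, fun i => ?_⟩
  · constructor
    · simp [pointMass_of_mem hc]
    · intro α _ β _
      exact mul_comm _ _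
    · intro β _
      by_cases h : x ∈ β
      · simpa [pointMass_of_mem h] using ColumnOK.indicator hA hx hc
      · simpa [pointMass_of_notMem h] using
          ColumnOK.zero ⟨x, mem_refinement_of_mem_cube hA k hx hc⟩
    · intro α _ β _ h
      rw [pointMass_mul]
      refine pointMass_of_notMem fun hαβ => ?_
      have : x ∈ convexHull ℝ α ∩ convexHull ℝ β ∩ polytope A b :=
        ⟨⟨subset_convexHull ℝ α hαβ.1, subset_convexHull ℝ β hαβ.2⟩, hx⟩
      rw [h] at this
      exact this
    · intro α₁ _ β₁ _ α₂ _ β₂ _ h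
      rw [pointMass_mul, pointMass_mul, h]
  · rcases hc i with h | h <;> simp [pointMass, onOne, hc, h]

theorem integerHull_subset_bzPlus {A : Matrix m ι ℝ} (hA : ∀ j i, 0 ≤ A j i) (b : m → ℝ) (k : ℕ) :
    integerHull (polytope A b) ⊆ bzPlus A b k :=
  convexHull_min (fun _ hx => mem_bzPlus_of_mem_cube hA k hx.1 hx.2) (bzPlus_convex A b k)

end IntegerHull
-- Nonnegative univariate polynomials and the gap polynomial
section Univariate

open Polynomial

/-- A nonnegative real polynomial that attains a zero is divisible by the square of the linear
factor, with nonnegative quotient. -/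
theorem exists_eq_sq_mul_of_nonneg (p : ℝ[X]) (hp : ∀ x, 0 ≤ p.eval x) (a : ℝ)
    (ha : p.eval a = 0) :
    ∃ q : ℝ[X], p = (X - C a) ^ 2 * q ∧ ∀ x, 0 ≤ q.eval x := by
  obtain ⟨r, hr⟩ := dvd_iff_isRoot.mpr ha
  -- A zero of a nonnegative function is a minimum, hence the root is double.
  have hder : p.derivative.eval a = 0 := by
    have hmin : IsLocalMin (fun x => p.eval x) a :=
      Filter.Eventually.of_forall fun x => by simpa [ha] using hp x
    simpa [Polynomial.deriv] using hmin.deriv_eq_zero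
  have hra : r.eval a = 0 := by
    rw [hr] at hder
    simpa [derivative_mul] using hder
  obtain ⟨q, hq⟩ := dvd_iff_isRoot.mpr hra
  have hpq : p = (X - C a) ^ 2 * q := by rw [hr, hq]; ring
  refine ⟨q, hpq, fun x => ?_⟩
  have hne : ∀ y, y ≠ a → 0 ≤ q.eval y := by
    intro y hy
    have h := hp y
    rw [hpq] at h
    simp only [eval_mul, eval_pow, eval_sub, eval_X, eval_C] at h
    have : 0 < (y - a) ^ 2 := by
      have := sub_ne_zero.mpr hy
      positivity
    exact nonneg_of_mul_nonneg_right h this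
  by_cases hx : x = a
  · subst hx
    have hcl : IsClosed {y | 0 ≤ q.eval y} := isClosed_le continuous_const q.continuous
    have hd : Dense ({x}ᶜ : Set ℝ) := dense_compl_singleton x
    exact hcl.closure_subset_iff.mpr (fun y hy => hne y hy) (hd x)
  · exact hne x hx

/-- A linear functional that is nonnegative on squares of polynomials of degree at most `L` is
nonnegative on the nonnegative polynomials of degree at most `2 L`. -/
theorem functional_nonneg_of_nonneg (L : ℕ) :
    ∀ (E : ℝ[X] →ₗ[ℝ] ℝ), (∀ p : ℝ[X], p.natDegree ≤ L → 0 ≤ E (p ^ 2)) →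
      ∀ p : ℝ[X], p.natDegree ≤ 2 * L → (∀ x, 0 ≤ p.eval x) → 0 ≤ E p := by
  have hconst : ∀ (L : ℕ) (E : ℝ[X] →ₗ[ℝ] ℝ),
      (∀ p : ℝ[X], p.natDegree ≤ L → 0 ≤ E (p ^ 2)) → ∀ c : ℝ, 0 ≤ c → 0 ≤ E (C c) := by
    intro L E hE c hc
    have := hE (C (Real.sqrt c)) (by simp)
    rwa [← C_pow, Real.sq_sqrt hc] at this
  induction L with
  | zero =>
    intro E hE p hp hpos
    have hpc := eq_C_of_natDegree_eq_zero (p := p) (by omega)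
    have h0 := hpos 0
    rw [hpc, eval_C] at h0
    rw [hpc]
    exact hconst 0 E hE _ h0
  | succ L ih =>
    intro E hE p hp hpos
    -- Subtracting the minimum value creates a double root `a`. The functional `q ↦ E ((X - a) ^ 2 *
    -- q)` satisfies the hypothesis one level lower, so induction handles the quotient.
    obtain ⟨a, ha⟩ := p.exists_forall_norm_le
    have hmin : ∀ y, p.eval a ≤ p.eval y := fun y => by
      have := ha y
      rwa [Real.norm_of_nonneg (hpos a), Real.norm_of_nonneg (hpos y)] at this
    obtain ⟨q, hq, hqpos⟩ := exists_eq_sq_mul_of_nonneg (p - C (p.eval a))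
      (fun x => by simpa using hmin x) a (by simp)
    have hpq : p = C (p.eval a) + (X - C a) ^ 2 * q := by rw [← hq]; ring
    have hqdeg : q.natDegree ≤ 2 * L := by
      by_cases hq0 : q = 0
      · simp [hq0]
      · have h1 : (p - C (p.eval a)).natDegree = 2 + q.natDegree := by
          rw [hq, natDegree_mul (pow_ne_zero _ (X_sub_C_ne_zero a)) hq0]
          simp
        have h2 : (p - C (p.eval a)).natDegree ≤ p.natDegree := by
          rw [natDegree_sub_C]
        omega
    have hE' := ih (E ∘ₗ LinearMap.mulLeft ℝ ((X - C a) ^ 2)) (fun r hr => by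
        have := hE ((X - C a) * r) (natDegree_mul_le.trans (by rw [natDegree_X_sub_C]; omega))
        rw [mul_pow] at this
        simpa using this) q hqdeg hqpos
    rw [hpq, map_add]
    have := hconst _ E hE _ (hpos a)
    simp only [LinearMap.comp_apply, LinearMap.mulLeft_apply] at hE'
    linarith

/-- A polynomial of degree at most `L` is on `ℕ` a combination of the binomial coefficients
`n.choose i` with `i ≤ L`. -/
theorem exists_eval_eq_sum_choose (L : ℕ) : ∀ p : ℝ[X], p.natDegree ≤ L →
    ∃ b : ℕ → ℝ, ∀ n : ℕ, p.eval (n : ℝ) = ∑ i ∈ Finset.range (L + 1), b i * (n.choose i : ℝ) := by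
  induction L with
  | zero =>
    intro p hp
    refine ⟨fun _ => p.coeff 0, fun n => ?_⟩
    rw [eq_C_of_natDegree_eq_zero (p := p) (by omega)]
    simp
  | succ L ih =>
    intro p hp
    obtain ⟨b, hb⟩ := ih p.divX (by rw [natDegree_divX_eq_natDegree_tsub_one]; omega)
    refine ⟨fun i => (if i = 0 then p.coeff 0 else 0) + (if i ≤ L then b i * i else 0)
      + (if i = 0 then 0 else b (i - 1) * i), fun n => ?_⟩
    -- Multiplication by `n` sends a binomial to a combination of itself and its successor; this is
    -- applied to `p = X * p.divX + C (p.coeff 0)`.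
    have key : ∀ i, (n : ℝ) * (n.choose i : ℝ)
        = i * (n.choose i : ℝ) + (i + 1 : ℝ) * (n.choose (i + 1) : ℝ) := by
      intro i
      have h := Nat.choose_succ_right_eq n i
      by_cases hi : i ≤ n
      · have h' : (n.choose (i + 1) : ℝ) * (i + 1) = n.choose i * ((n : ℝ) - i) := by
          rw [← Nat.cast_sub hi]
          exact_mod_cast h
        linarith
      · rw [Nat.choose_eq_zero_of_lt (by omega), Nat.choose_eq_zero_of_lt (by omega)]
        simp
    have e1 : p.eval (n : ℝ) = (n : ℝ) * p.divX.eval (n : ℝ) + p.coeff 0 := by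
      conv_lhs => rw [← X_mul_divX_add p, eval_add, eval_C, eval_mul, eval_X]
    rw [e1, hb]
    simp only [add_mul, Finset.sum_add_distrib]
    have s1 : ∑ i ∈ Finset.range (L + 1 + 1), (if i = 0 then p.coeff 0 else 0) * (n.choose i : ℝ)
        = p.coeff 0 := by
      rw [Finset.sum_range_succ']
      simp
    have s2 : ∑ i ∈ Finset.range (L + 1 + 1), (if i ≤ L then b i * i else 0) * (n.choose i : ℝ)
        = ∑ i ∈ Finset.range (L + 1), b i * i * (n.choose i : ℝ) := by
      rw [Finset.sum_range_succ, if_neg (by omega), zero_mul, add_zero]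
      refine Finset.sum_congr rfl fun i hi => ?_
      rw [if_pos (by have := Finset.mem_range.mp hi; omega)]
    have s3 : ∑ i ∈ Finset.range (L + 1 + 1),
        (if i = 0 then 0 else b (i - 1) * i) * (n.choose i : ℝ)
        = ∑ i ∈ Finset.range (L + 1), b i * (i + 1 : ℝ) * (n.choose (i + 1) : ℝ) := by
      rw [Finset.sum_range_succ']
      simp
    rw [s1, s2, s3, Finset.mul_sum, add_comm, add_assoc, ← Finset.sum_add_distrib]
    congr 1
    refine Finset.sum_congr rfl fun i _ => ?_
    linear_combination b i * key i

theorem abs_prod_range_sub_le (d : ℕ) (y : ℝ) (h0 : 0 ≤ y) (hd : y ≤ d) :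
    |∏ i ∈ Finset.range d, (y - i)| ≤ d.factorial := by
  induction d with
  | zero => simp
  | succ d ih =>
    by_cases hy : y ≤ d
    · rw [Finset.prod_range_succ, abs_mul, Nat.factorial_succ, Nat.cast_mul, mul_comm]
      have : |y - d| ≤ ((d + 1 : ℕ) : ℝ) := by
        rw [abs_le]; push_cast; constructor <;> linarith
      exact mul_le_mul this (ih hy) (abs_nonneg _) (by positivity)
    -- For `d < y ≤ d + 1` all factors are nonnegative, and `y - i ≤ d + 1 - i` bounds them one by
    -- one.
    · push Not at hy
      rw [Finset.abs_prod, ← Finset.prod_range_add_one_eq_factorial, ← Finset.prod_range_reflect,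
        Nat.cast_prod]
      refine Finset.prod_le_prod (fun _ _ => abs_nonneg _) fun i hi => ?_
      have hi' := Finset.mem_range.mp hi
      have h2 : ((d + 1 - 1 - i : ℕ) : ℝ) = d - i := by
        rw [Nat.add_sub_cancel, Nat.cast_sub (by omega)]
      have hi2 : (i : ℝ) ≤ d := by exact_mod_cast (by omega : i ≤ d)
      rw [h2, abs_of_nonneg (by linarith [(Nat.cast_nonneg i : (0 : ℝ) ≤ i)])]
      push_cast at hd ⊢
      linarith

theorem factorial_le_prod_range_sub (d : ℕ) (y : ℝ) (hd : d ≤ y) :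
    (d.factorial : ℝ) ≤ ∏ i ∈ Finset.range d, (y - i) := by
  rw [← Finset.prod_range_add_one_eq_factorial, ← Finset.prod_range_reflect, Nat.cast_prod]
  refine Finset.prod_le_prod (fun _ _ => by positivity) fun i hi => ?_
  have hi' := Finset.mem_range.mp hi
  have h2 : ((d - 1 - i + 1 : ℕ) : ℝ) = d - i := by
    rw [← Nat.cast_sub (by omega)]
    congr 1
    omega
  rw [h2]
  linarith

/-- The polynomial `(d - X) (1 - X (X - 1) ⋯ (X - d + 1) / d!)`. -/
noncomputable def gapPoly (d : ℕ) : ℝ[X] :=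
  (C (d : ℝ) - X) * (1 - C ((d.factorial : ℝ)⁻¹) * ∏ i ∈ Finset.range d, (X - C (i : ℝ)))

theorem gapPoly_eval (d : ℕ) (y : ℝ) : (gapPoly d).eval y
    = (d - y) * (1 - (d.factorial : ℝ)⁻¹ * ∏ i ∈ Finset.range d, (y - i)) := by
  simp [gapPoly, eval_prod]

/-- The falling factorial vanishes for `j < d`, and the linear factor vanishes for `j = d`. -/
theorem gapPoly_eval_nat (d j : ℕ) (hj : j ≤ d) : (gapPoly d).eval (j : ℝ) = d - j := by
  rw [gapPoly_eval]
  rcases hj.lt_or_eq with h | h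
  · rw [Finset.prod_eq_zero (Finset.mem_range.mpr h) (sub_self _)]
    ring
  · rw [h]; ring

theorem gapPoly_natDegree_le (d : ℕ) : (gapPoly d).natDegree ≤ d + 1 := by
  refine natDegree_mul_le.trans ?_
  have h1 : (C (d : ℝ) - X : ℝ[X]).natDegree ≤ 1 := by
    refine (natDegree_sub_le _ _).trans ?_
    simp
  have h2 : (∏ i ∈ Finset.range d, (X - C (i : ℝ))).natDegree = d := by
    rw [natDegree_prod_of_monic _ _ fun i _ => monic_X_sub_C _]
    simp only [natDegree_X_sub_C, Finset.sum_const, Finset.card_range, smul_eq_mul, mul_one]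
  have h3 : (1 - C ((d.factorial : ℝ)⁻¹) * ∏ i ∈ Finset.range d, (X - C (i : ℝ))).natDegree ≤ d := by
    refine (natDegree_sub_le _ _).trans ?_
    rw [natDegree_one]
    exact max_le (Nat.zero_le _) ((natDegree_C_mul_le _ _).trans h2.le)
  omega

/-- Beyond `d` both factors are nonpositive. On `[0, d]` the falling factorial is at most `d!` in
absolute value. Below zero it is a product of an odd number of negative factors; this is where
oddness enters. -/
theorem gapPoly_nonneg (d : ℕ) (hd : Odd d) (y : ℝ) : 0 ≤ (gapPoly d).eval y := by
  rw [gapPoly_eval]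
  have hf : (0 : ℝ) < d.factorial := by exact_mod_cast d.factorial_pos
  have hle : ∀ t : ℝ, t ≤ d.factorial → 0 ≤ 1 - (d.factorial : ℝ)⁻¹ * t := fun t ht => by
    rw [sub_nonneg, inv_mul_le_iff₀ hf, mul_one]
    exact ht
  rcases le_or_gt (d : ℝ) y with h | h
  · have h1 := factorial_le_prod_range_sub d y h
    have h2 : 1 ≤ (d.factorial : ℝ)⁻¹ * ∏ i ∈ Finset.range d, (y - i) := by
      rw [le_inv_mul_iff₀ hf, mul_one]
      exact h1
    exact mul_nonneg_of_nonpos_of_nonpos (by linarith) (by linarith)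
  · refine mul_nonneg (by linarith) (hle _ ?_)
    rcases le_or_gt 0 y with h0 | h0
    · exact (le_abs_self _).trans (abs_prod_range_sub_le d y h0 h.le)
    · have e : ∏ i ∈ Finset.range d, (y - i) = - ∏ i ∈ Finset.range d, (i - y) := by
        have := Finset.prod_neg (s := Finset.range d) (fun i : ℕ => (i : ℝ) - y)
        rw [Finset.card_range, hd.neg_one_pow, neg_one_mul] at this
        simpa using this
      have : 0 ≤ ∏ i ∈ Finset.range d, ((i : ℝ) - y) :=
        Finset.prod_nonneg fun i _ => by
          have : (0 : ℝ) ≤ i := Nat.cast_nonneg i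
          linarith
      rw [e]
      linarith

end Univariate

/-! ### Weighted matchings and the odd set inequalities -/

section OddSetInequalities

variable {V : Type*}

/-- Both involutions conjugate `σ` to its inverse, so on the orbit of `t`, the alternating path
through `t`, they act as reflections of the exponent. -/
theorem apply_zpow_mul_of_involutions {σ f g : Equiv.Perm V} (hf : f * f = 1) (hg : g * g = 1)
    (hσ : σ = f * g) {t : V} (ht : g t = t) (i : ℤ) :
    f ((σ ^ i) t) = (σ ^ (1 - i)) t ∧ g ((σ ^ i) t) = (σ ^ (-i)) t := by
  have hf' : f⁻¹ = f := inv_eq_of_mul_eq_one_left hf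
  have hg' : g⁻¹ = g := inv_eq_of_mul_eq_one_left hg
  have cf : f * σ ^ i = σ ^ (-i) * f := by
    have : f * σ * f⁻¹ = σ⁻¹ := by
      rw [hσ, mul_inv_rev, hf', hg', ← mul_assoc, hf, one_mul]
    rw [zpow_neg, ← inv_zpow, ← this, conj_zpow, inv_mul_cancel_right]
  have cg : g * σ ^ i = σ ^ (-i) * g := by
    have : g * σ * g⁻¹ = σ⁻¹ := by
      rw [hσ, mul_inv_rev, hf', hg', mul_assoc, mul_assoc, hg, mul_one]
    rw [zpow_neg, ← inv_zpow, ← this, conj_zpow, inv_mul_cancel_right]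
  constructor
  · have h1 : f t = σ t := by rw [hσ, Equiv.Perm.mul_apply, ht]
    rw [← Equiv.Perm.mul_apply, cf, Equiv.Perm.mul_apply, h1, ← Equiv.Perm.mul_apply,
      ← zpow_add_one]
    congr 2
    ring
  · rw [← Equiv.Perm.mul_apply, cg, Equiv.Perm.mul_apply, ht]

/-- Two involutions `f`, `g` and a fixed point `t` of `g` lie in a common invariant set that
contains at most one fixed point of `f`. -/
theorem exists_invariant_set {f g : V → V} (hf : Function.Involutive f)
    (hg : Function.Involutive g) {t : V} (ht : g t = t) :
    ∃ C : Set V, t ∈ C ∧ (∀ v, f v ∈ C ↔ v ∈ C) ∧ (∀ v, g v ∈ C ↔ v ∈ C) ∧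
      ∀ a ∈ C, ∀ b ∈ C, f a = a → f b = b → a = b := by
  set F : Equiv.Perm V := hf.toPerm with hF
  set G : Equiv.Perm V := hg.toPerm with hG
  have hFF : F * F = 1 := Equiv.ext fun v => hf v
  have hGG : G * G = 1 := Equiv.ext fun v => hg v
  have key := fun i => apply_zpow_mul_of_involutions hFF hGG rfl (show G t = t from ht) i
  set σ := F * G with hσ
  have cf : ∀ v, (∃ i : ℤ, (σ ^ i) t = v) → ∃ i : ℤ, (σ ^ i) t = f v := by
    rintro _ ⟨i, rfl⟩
    exact ⟨1 - i, (key i).1.symm⟩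
  have cg : ∀ v, (∃ i : ℤ, (σ ^ i) t = v) → ∃ i : ℤ, (σ ^ i) t = g v := by
    rintro _ ⟨i, rfl⟩
    exact ⟨-i, (key i).2.symm⟩
  refine ⟨{v | ∃ i : ℤ, (σ ^ i) t = v}, ⟨0, rfl⟩,
    fun v => ⟨fun h => by simpa [hf v] using cf _ h, cf v⟩,
    fun v => ⟨fun h => by simpa [hg v] using cg _ h, cg v⟩, ?_⟩
  rintro _ ⟨i, rfl⟩ _ ⟨j, rfl⟩ ha hb
  have hmul : ∀ p q : ℤ, (σ ^ p) t = t → (σ ^ (p * q)) t = t := fun p q h => by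
    rw [zpow_mul]
    exact Equiv.Perm.zpow_apply_eq_self_of_apply_eq_self h q
  have hsub : ∀ p q : ℤ, (σ ^ p) t = (σ ^ q) t ↔ (σ ^ (p - q)) t = t := fun p q => by
    rw [sub_eq_neg_add, zpow_add, Equiv.Perm.mul_apply, zpow_neg, Equiv.Perm.inv_eq_iff_eq]
  have h1 := (hsub _ _).mp ((key i).1.symm.trans ha)
  have h2 := (hsub _ _).mp ((key j).1.symm.trans hb)
  have h3 : (σ ^ (2 * (j - i))) t = t := by
    rw [show 2 * (j - i) = (1 - i - i) - (1 - j - j) by ring]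
    exact (hsub _ _).mp (h1.trans h2.symm)
  rw [hsub]
  have h4 := hmul _ i h3
  have h5 := hmul _ (i - j) h1
  -- The exponents `1 - 2 i` and `2 (j - i)` both fix `t`. The first is odd, so a Bézout combination
  -- shows that `i - j` fixes `t` as well.
  rw [show i - j = (1 - i - i) * (i - j) - 2 * (j - i) * i by ring]
  exact (hsub _ _).mp (h5.trans h4.symm)

/-- The pairs of the involution `f` all have positive weight. -/
def IsSupported (c : V → V → ℕ) (f : V → V) : Prop := ∀ v, f v = v ∨ 0 < c v (f v)

/-- The pairs of weight zero can be removed from an involution. -/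
theorem exists_supported {c : V → V → ℕ} (hc : ∀ u v, c u v = c v u)
    {f : V → V} (hf : Function.Involutive f) :
    ∃ g, Function.Involutive g ∧ IsSupported c g ∧ (∀ v, c v (f v) = 0 → g v = v) ∧
      ∀ v, 0 < c v (f v) → g v = f v := by
  classical
  refine ⟨fun v => if 0 < c v (f v) then f v else v, fun v => ?_, fun v => ?_, fun v hv => ?_,
    fun v hv => if_pos hv⟩
  · by_cases h : 0 < c v (f v)
    · simp [h, hf v, hc (f v) v]
    · simp [h]
  · by_cases h : 0 < c v (f v)
    · simp [h]
    · simp [h]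
  · simp [hv]

theorem involutive_piecewise {f g : V → V} (hf : Function.Involutive f)
    (hg : Function.Involutive g) (C : Set V) [DecidablePred (· ∈ C)] (hfC : ∀ v, f v ∈ C ↔ v ∈ C)
    (hgC : ∀ v, g v ∈ C ↔ v ∈ C) : Function.Involutive (C.piecewise g f) := by
  intro v
  by_cases h : v ∈ C
  · simp [Set.piecewise, h, (hgC v).mpr h, hg v]
  · simp [Set.piecewise, h, (not_congr (hfC v)).mpr h, hf v]

theorem isSupported_piecewise {c : V → V → ℕ} {f g : V → V} (hf : IsSupported c f)
    (hg : IsSupported c g) (C : Set V) [DecidablePred (· ∈ C)] :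
    IsSupported c (C.piecewise g f) := by
  intro v
  by_cases h : v ∈ C
  · simpa [Set.piecewise, h] using hg v
  · simpa [Set.piecewise, h] using hf v

variable [Fintype V]

/-- Twice the weight of the matching that is encoded by the involution `f`. -/
def involutionWeight (c : V → V → ℕ) (f : V → V) : ℕ := ∑ v, c v (f v)

/-- Each pair is counted from both ends. The parity later turns a strict drop of the weight into a
drop by two, and absorbs a slack of one. -/
theorem even_involutionWeight {c : V → V → ℕ} (hc : ∀ u v, c u v = c v u) (hc0 : ∀ v, c v v = 0)
    {f : V → V} (hf : Function.Involutive f) : Even (involutionWeight c f) := by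
  rw [← ZMod.natCast_eq_zero_iff_even, involutionWeight, Nat.cast_sum]
  refine Finset.sum_involution (fun v _ => f v) ?_ ?_ (fun _ _ => Finset.mem_univ _)
    (fun v _ => hf v)
  · intro v _
    rw [hf v, hc (f v) v]
    exact CharTwo.add_self_eq_zero _
  · intro v _ h e
    rw [e, hc0] at h
    simp at h

theorem exists_max_of_involutive [DecidableEq V] (Φ : (V → V) → ℕ) (p : (V → V) → Prop) (hp : p id) :
    ∃ f, (Function.Involutive f ∧ p f) ∧
      ∀ g, Function.Involutive g → p g → Φ g ≤ Φ f := by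
  obtain ⟨f, hf, h⟩ := Set.exists_max_image {f : V → V | Function.Involutive f ∧ p f} Φ
    (Set.toFinite _) ⟨id, fun _ => rfl, hp⟩
  exact ⟨f, hf, fun g hg hpg => h g ⟨hg, hpg⟩⟩

theorem involutionWeight_piecewise_add (c : V → V → ℕ) (f g : V → V) (C : Set V)
    [DecidablePred (· ∈ C)] :
    involutionWeight c (C.piecewise g f) + involutionWeight c (C.piecewise f g)
      = involutionWeight c f + involutionWeight c g := by
  simp only [involutionWeight, ← Finset.sum_add_distrib]
  refine Finset.sum_congr rfl fun v _ => ?_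
  by_cases h : v ∈ C
  · simp [Set.piecewise, h, add_comm]
  · simp [Set.piecewise, h]

/-- If every vertex is missed by some matching of maximum weight, then for the weights lowered by
one on a connected component there is a maximum matching that misses at most one vertex of it. -/
theorem exists_max_missing_at_most_one [DecidableEq V] {c : V → V → ℕ}
    (hc : ∀ u v, c u v = c v u) (hc0 : ∀ v, c v v = 0)
    (hmiss : ∀ u, ∃ g, Function.Involutive g ∧ IsSupported c g ∧ g u = u ∧
      ∀ h, Function.Involutive h → involutionWeight c h ≤ involutionWeight c g)
    (W : Finset V) (hcl : ∀ a ∈ W, ∀ b, 0 < c a b → b ∈ W)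
    (hconn : ∀ a ∈ W, ∀ b ∈ W, Relation.ReflTransGen (fun a b => 0 < c a b) a b) :
    ∃ f, Function.Involutive f ∧ involutionWeight (fun a b => if a ∈ W then c a b - 1 else c a b) f
        + W.card ≤ involutionWeight c f + 1 ∧
      ∀ g, Function.Involutive g →
        involutionWeight (fun a b => if a ∈ W then c a b - 1 else c a b) g ≤
          involutionWeight (fun a b => if a ∈ W then c a b - 1 else c a b) f := by
  classical
  set c' : V → V → ℕ := fun a b => if a ∈ W then c a b - 1 else c a b with hc'
  set cov : (V → V) → ℕ := fun f => (W.filter fun v => ¬ f v = v).card with hcov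
  set fixW : (V → V) → Finset V := fun f => W.filter fun v => f v = v with hfix
  have hcf : ∀ f, (fixW f).card + cov f = W.card := fun f =>
    Finset.card_filter_add_card_filter_not _
  -- On pairs of positive weight the truncated subtraction is exact, so each covered vertex of `W`
  -- accounts for one unit.
  have hw : ∀ f, IsSupported c f → involutionWeight c f = involutionWeight c' f + cov f := by
    intro f hf
    simp only [hcov, Finset.card_filter, involutionWeight]
    rw [← Finset.sum_filter_add_sum_filter_not Finset.univ (· ∈ W),
      ← Finset.sum_filter_add_sum_filter_not Finset.univ (· ∈ W) (fun v => c' v (f v))]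
    have e1 : ∑ v with v ∈ W, c v (f v)
        = ∑ v with v ∈ W, c' v (f v) + ∑ v ∈ W, if ¬ f v = v then 1 else 0 := by
      rw [Finset.filter_univ_mem, ← Finset.sum_add_distrib]
      refine Finset.sum_congr rfl fun v hv => ?_
      rcases hf v with h | h
      · simp [h, hc', hv, hc0]
      · have : f v ≠ v := fun e => by rw [e, hc0] at h; exact lt_irrefl _ h
        simp only [hc', hv, if_true, this, not_false_eq_true]
        omega
    have e2 : ∑ v with v ∉ W, c v (f v) = ∑ v with v ∉ W, c' v (f v) := by
      refine Finset.sum_congr rfl fun v hv => ?_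
      simp [hc', (Finset.mem_filter.mp hv).2]
    rw [e1, e2]
    ring
  -- `K` exceeds every value of `cov`, so maximizing `Φ` is lexicographic: lowered weight first,
  -- then coverage of `W`.
  set K := Fintype.card V + 1 with hK
  have hcovK : ∀ f, cov f < K := fun f =>
    Nat.lt_succ_of_le (Finset.card_le_univ _)
  set Φ : (V → V) → ℕ := fun f => K * involutionWeight c' f + cov f with hΦ
  obtain ⟨f, ⟨hf, hfs⟩, hmax⟩ := exists_max_of_involutive Φ (IsSupported c) (fun v => Or.inl rfl)
  -- Matching two missed vertices joined by positive weight does not decrease the lowered weight and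
  -- raises the coverage.
  have adj : ∀ f, Function.Involutive f → IsSupported c f →
      (∀ g, Function.Involutive g → IsSupported c g → Φ g ≤ Φ f) →
      ∀ a b, a ∈ W → 0 < c a b → f a = a → f b = b → False := by
    intro f hf hfs hmax a b haW hab ha hb
    have hne : a ≠ b := fun e => by rw [e, hc0] at hab; exact lt_irrefl _ hab
    set g : V → V := fun v => if v = a then b else if v = b then a else f v with hg
    have hga : g a = b := by simp [hg]
    have hgb : g b = a := by simp [hg, hne.symm]
    have hgv : ∀ v, v ≠ a → v ≠ b → g v = f v := fun v h1 h2 => by simp [hg, h1, h2]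
    have hgi : Function.Involutive g := by
      intro v
      by_cases h1 : v = a
      · rw [h1, hga, hgb]
      by_cases h2 : v = b
      · rw [h2, hgb, hga]
      have h3 : f v ≠ a := fun e => h1 (by rw [← hf v, e, ha])
      have h4 : f v ≠ b := fun e => h2 (by rw [← hf v, e, hb])
      rw [hgv v h1 h2, hgv _ h3 h4, hf v]
    have hgs : IsSupported c g := by
      intro v
      by_cases h1 : v = a
      · rw [h1, hga]; exact Or.inr hab
      by_cases h2 : v = b
      · rw [h2, hgb, hc]; exact Or.inr hab
      rw [hgv v h1 h2]
      exact hfs v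
    have h1 : involutionWeight c' f ≤ involutionWeight c' g := by
      refine Finset.sum_le_sum fun v _ => ?_
      have hd : ∀ v, c' v v = 0 := fun v => by simp [hc', hc0]
      by_cases h1 : v = a
      · rw [h1, ha, hd]; exact Nat.zero_le _
      by_cases h2 : v = b
      · rw [h2, hb, hd]; exact Nat.zero_le _
      rw [hgv v h1 h2]
    have h2 : cov f < cov g := by
      refine Finset.card_lt_card ?_
      rw [Finset.ssubset_iff_of_subset]
      · exact ⟨a, by simp [haW, hga, hne.symm], by simp [ha]⟩
      · intro v hv
        rw [Finset.mem_filter] at hv ⊢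
        have h1 : v ≠ a := fun e => hv.2 (by rw [e, ha])
        have h2 : v ≠ b := fun e => hv.2 (by rw [e, hb])
        rw [hgv v h1 h2]
        exact hv
    have h3 := hmax g hgi hgs
    have h4 := Nat.mul_le_mul_left K h1
    simp only [hΦ] at h3
    omega
  -- Exchange `f` with a `c`-maximal `g` missing `t` on the alternating component `C` of `t`. The
  -- complementary exchange cannot beat `g`, so `f'` has at least the `c`-weight of `f`. On `C` at
  -- most one missed vertex is lost while `t` is missed, so coverage does not grow; any loss of
  -- coverage is made up by lowered weight, and `f'` stays `Φ`-maximal.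
  have switch : ∀ f, Function.Involutive f → IsSupported c f →
      (∀ g, Function.Involutive g → IsSupported c g → Φ g ≤ Φ f) →
      ∀ a b t, a ≠ b → t ∈ W → f a = a → f b = b →
      ∃ f', (Function.Involutive f' ∧ IsSupported c f' ∧
        ∀ g, Function.Involutive g → IsSupported c g → Φ g ≤ Φ f') ∧ f' t = t ∧
          (f' a = a ∨ f' b = b) := by
    intro f hf hfs hmax a b t hab htW ha hb
    obtain ⟨g, hg, hgs, hgt, hgmax⟩ := hmiss t
    obtain ⟨C, htC, hfC, hgC, huniq⟩ := exists_invariant_set hf hg hgt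
    have hi := involutive_piecewise hf hg C hfC hgC
    have hs := isSupported_piecewise hfs hgs C
    have hsum := involutionWeight_piecewise_add c f g C
    have hle := hgmax _ (involutive_piecewise hg hf C hgC hfC)
    set f' := C.piecewise g f with hf'
    have hin : ∀ v ∈ C, f' v = g v := fun v hv => Set.piecewise_eq_of_mem _ _ _ hv
    have hout : ∀ v, v ∉ C → f' v = f v := fun v hv => Set.piecewise_eq_of_notMem _ _ _ hv
    refine ⟨f', ⟨hi, hs, fun h hh hhs => (hmax h hh hhs).trans ?_⟩, ?_, ?_⟩
    · have hfx : (fixW f).card ≤ (fixW f').card := by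
        have htm : t ∈ fixW f' := Finset.mem_filter.mpr ⟨htW, by rw [hin t htC, hgt]⟩
        have hsub : fixW f ⊆ (fixW f').erase t ∪ (fixW f).filter (· ∈ C) := by
          intro v hv
          have hv' := Finset.mem_filter.mp hv
          by_cases hvC : v ∈ C
          · exact Finset.mem_union_right _ (Finset.mem_filter.mpr ⟨hv, hvC⟩)
          · refine Finset.mem_union_left _ (Finset.mem_erase.mpr ⟨fun e => hvC (e ▸ htC), ?_⟩)
            exact Finset.mem_filter.mpr ⟨hv'.1, by rw [hout v hvC, hv'.2]⟩
        have hone : ((fixW f).filter (· ∈ C)).card ≤ 1 := by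
          refine Finset.card_le_one.mpr fun u hu v hv => ?_
          have hu' := Finset.mem_filter.mp hu
          have hv' := Finset.mem_filter.mp hv
          exact huniq u hu'.2 v hv'.2 (Finset.mem_filter.mp hu'.1).2 (Finset.mem_filter.mp hv'.1).2
        have h1 := (Finset.card_le_card hsub).trans (Finset.card_union_le _ _)
        have h2 := Finset.card_erase_add_one htm
        omega
      have e1 := hw f hfs
      have e2 := hw f' hs
      have e3 := hcf f
      have e4 := hcf f'
      obtain ⟨δ, hδ⟩ : ∃ δ, involutionWeight c' f' = involutionWeight c' f + δ :=
        ⟨involutionWeight c' f' - involutionWeight c' f, by omega⟩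
      have h5 : cov f ≤ cov f' + δ := by omega
      have h6 : δ ≤ K * δ := Nat.le_mul_of_pos_left _ (by omega)
      simp only [hΦ, hδ, mul_add]
      omega
    · rw [hin t htC, hgt]
    · by_cases haC : a ∈ C
      · right
        have hbC : b ∉ C := fun hbC => hab (huniq a haC b hbC ha hb)
        rw [hout b hbC, hb]
      · left
        rw [hout a haC, ha]
  -- Induction along a positive path from `a` to `b`: switching makes its second vertex `s` missed
  -- together with `a` or `b`. The first option contradicts `adj`, the second shortens the path.
  have nopair : ∀ a b, Relation.ReflTransGen (fun a b => 0 < c a b) a b → a ∈ W →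
      ∀ f, Function.Involutive f → IsSupported c f →
      (∀ g, Function.Involutive g → IsSupported c g → Φ g ≤ Φ f) →
      a ≠ b → f a = a → f b = b → False := by
    intro a b hab
    induction hab using Relation.ReflTransGen.head_induction_on with
    | refl => intro _ f _ _ _ h _ _; exact h rfl
    | @head a s has _ ih =>
      intro haW f hf hfs hmax hne ha hb
      have hsW := hcl a haW s has
      by_cases hsb : s = b
      · exact adj f hf hfs hmax a s haW has ha (by rw [hsb, hb])
      obtain ⟨f', ⟨hf', hfs', hmax'⟩, hs, h | h⟩ := switch f hf hfs hmax a b s hne hsW ha hb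
      · exact adj f' hf' hfs' hmax' a s haW has h hs
      · exact ih hsW f' hf' hfs' hmax' hsb hs h
  have hone : (fixW f).card ≤ 1 := by
    refine Finset.card_le_one.mpr fun a ha b hb => ?_
    by_contra hne
    have ha' := Finset.mem_filter.mp ha
    have hb' := Finset.mem_filter.mp hb
    exact nopair a b (hconn a ha'.1 b hb'.1) ha'.1 f hf hfs hmax hne ha'.2 hb'.2
  refine ⟨f, hf, ?_, fun g hg => ?_⟩
  · have := hcf f
    have := hw f hfs
    omega
  · obtain ⟨h, hh, hhs, h0, h1⟩ := exists_supported hc hg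
    have e : involutionWeight c' g ≤ involutionWeight c' h := by
      refine Finset.sum_le_sum fun v _ => ?_
      rcases Nat.eq_zero_or_pos (c v (g v)) with hz | hz
      · have : c' v (g v) = 0 := by simp [hc', hz]
        rw [this]; exact Nat.zero_le _
      · rw [h1 v hz]
    refine e.trans ?_
    have h2 := hmax h hh hhs
    have h3 := hcovK f
    simp only [hΦ] at h2
    by_contra hlt
    push Not at hlt
    have := Nat.mul_le_mul_left K (Nat.succ_le_of_lt hlt)
    rw [Nat.mul_succ] at this
    omega

/-- The weighted form of the description of the matching polytope of a complete graph by the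
degree and the odd set inequalities. Matchings are encoded as involutions. -/
theorem exists_involution_weight_ge [DecidableEq V] {x : V → V → ℝ} (hx : ∀ u v, x u v = x v u)
    (hx0 : ∀ u v, 0 ≤ x u v) (hdeg : ∀ u, ∑ v, x u v ≤ 1)
    (hodd : ∀ W : Finset V, Odd W.card → ∑ u ∈ W, ∑ v ∈ W, x u v ≤ W.card - 1)
    (c : V → V → ℕ) (hc : ∀ u v, c u v = c v u) (hc0 : ∀ v, c v v = 0) :
    ∃ f, Function.Involutive f ∧ ∑ u, ∑ v, c u v * x u v ≤ involutionWeight c f := by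
  classical
  induction hN : ∑ u, ∑ v, c u v using Nat.strong_induction_on generalizing c with
  | _ N ih =>
  obtain ⟨f, ⟨hf, -⟩, hfmax⟩ := exists_max_of_involutive (involutionWeight c) (fun _ => True) trivial
  refine ⟨f, hf, ?_⟩
  have lt_sum : ∀ c' : V → V → ℕ, (∀ a b, c' a b ≤ c a b) → ∀ a b, c' a b < c a b →
      ∑ u, ∑ v, c' u v < N := by
    intro c' hle a b hlt
    rw [← hN]
    refine Finset.sum_lt_sum (fun u _ => Finset.sum_le_sum fun v _ => hle u v)
      ⟨a, Finset.mem_univ _, Finset.sum_lt_sum (fun v _ => hle a v) ⟨b, Finset.mem_univ _, hlt⟩⟩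
  -- If some vertex `u` is covered with positive weight by every maximum matching, lower the weights
  -- at `u` and let the degree inequality at `u` pay for the drop.
  by_cases hcase : ∃ u, ∀ g, Function.Involutive g →
      (∀ h, Function.Involutive h → involutionWeight c h ≤ involutionWeight c g) → 0 < c u (g u)
  · obtain ⟨u, hu⟩ := hcase
    set c' : V → V → ℕ := fun a b => if a = u ∨ b = u then c a b - 1 else c a b with hc'
    have hle : ∀ a b, c' a b ≤ c a b := fun a b => by
      simp only [hc']; split_ifs <;> omega
    have hpos := hu f hf fun h hh => hfmax h hh trivial
    obtain ⟨f', hf', hwt⟩ := ih _ (lt_sum c' hle u (f u) (by simp [hc']; omega)) c'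
      (fun a b => by simp only [hc', hc a b, or_comm]) (fun v => by simp [hc', hc0]) rfl
    -- If `f'` is maximal for `c`, both ends of its pair at `u` lose one unit; otherwise parity
    -- gives a gap of two.
    have hdrop : involutionWeight c' f' + 2 ≤ involutionWeight c f := by
      by_cases hm : ∀ h, Function.Involutive h → involutionWeight c h ≤ involutionWeight c f'
      · have hp := hu f' hf' hm
        have hne : u ≠ f' u := fun e => by rw [← e, hc0] at hp; exact lt_irrefl _ hp
        refine le_trans ?_ (hfmax f' hf' trivial)
        have : ∑ v, (c' v (f' v) + (if v = u then 1 else 0) + (if v = f' u then 1 else 0))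
            ≤ ∑ v, c v (f' v) := by
          refine Finset.sum_le_sum fun v _ => ?_
          by_cases h1 : v = u
          · subst h1
            simp only [hc', true_or, if_true, hne, if_false]
            omega
          · by_cases h2 : v = f' u
            · have h3 : f' v = u := by rw [h2, hf' u]
              have h4 : 0 < c v u := by rw [hc, h2]; exact hp
              simp only [hc', h3, or_true, if_true, h1, if_false, h2.symm]
              simp only [h2]
              rw [← h2]
              omega
            · simpa [h1, h2] using hle v (f' v)
        simp only [Finset.sum_add_distrib, Finset.sum_ite_eq', Finset.mem_univ, if_true] at this
        simp only [involutionWeight]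
        omega
      · push Not at hm
        obtain ⟨h, hh, hlt⟩ := hm
        have h1 : involutionWeight c' f' ≤ involutionWeight c f' :=
          Finset.sum_le_sum fun v _ => hle _ _
        have h2 := hfmax h hh trivial
        obtain ⟨p, hp⟩ := even_involutionWeight hc hc0 hf'
        obtain ⟨q, hq⟩ := even_involutionWeight hc hc0 hf
        omega
    have hsum : ∑ a, ∑ b, c a b * x a b ≤ ∑ a, ∑ b, c' a b * x a b + 2 := by
      have h1 : ∑ a, ∑ b, (c a b : ℝ) * x a b ≤ ∑ a, ∑ b, (c' a b * x a b
          + (if a = u then x a b else 0) + (if b = u then x a b else 0)) := by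
        refine Finset.sum_le_sum fun a _ => Finset.sum_le_sum fun b _ => ?_
        have hxx := hx0 a b
        have h2 : (c a b : ℝ) ≤ c' a b + 1 := by
          have : c a b ≤ c' a b + 1 := by simp only [hc']; split_ifs <;> omega
          exact_mod_cast this
        have h3 := mul_le_mul_of_nonneg_right h2 hxx
        by_cases ha : a = u
        · by_cases hb : b = u
          · simp only [ha, hb, if_true] at *
            linarith
          · simp only [ha, hb, if_true, if_false] at *
            linarith
        · by_cases hb : b = u
          · simp only [ha, hb, if_true, if_false] at *
            linarith
          · simp [hc', ha, hb]
      have h2 : ∑ a, ∑ b, (if a = u then x a b else 0) ≤ 1 := by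
        rw [Finset.sum_eq_single u (fun a _ h => by simp [h]) (by simp)]
        simpa using hdeg u
      have h3 : ∑ a, ∑ b, (if b = u then x a b else 0) ≤ 1 := by
        simp only [Finset.sum_ite_eq', Finset.mem_univ, if_true, hx _ u]
        exact hdeg u
      simp only [Finset.sum_add_distrib] at h1
      linarith
    have : (involutionWeight c' f' : ℝ) + 2 ≤ involutionWeight c f := by exact_mod_cast hdrop
    linarith
  · push Not at hcase
    by_cases hzero : ∀ a b, c a b = 0
    · simp [hzero]
    push Not at hzero
    obtain ⟨a₀, b₀, h₀⟩ := hzero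
    -- Every vertex is now missed by some maximum matching. The weights are lowered on one component
    -- `W` of the positive pairs, which costs the maximum at least `|W| - 1`.
    set W : Finset V := Finset.univ.filter fun v => Relation.ReflTransGen (fun a b => 0 < c a b) a₀ v
      with hW
    have hcl : ∀ a ∈ W, ∀ b, 0 < c a b → b ∈ W := by
      intro a ha b hab
      simp only [hW, Finset.mem_filter, Finset.mem_univ, true_and] at ha ⊢
      exact ha.tail hab
    have hconn : ∀ a ∈ W, ∀ b ∈ W, Relation.ReflTransGen (fun a b => 0 < c a b) a b := by
      intro a ha b hb
      simp only [hW, Finset.mem_filter, Finset.mem_univ, true_and] at ha hb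
      have : Std.Symm fun a b : V => 0 < c a b := ⟨fun p q h => by rwa [hc]⟩
      exact (Std.Symm.symm _ _ ha).trans hb
    have hmiss : ∀ u, ∃ g, Function.Involutive g ∧ IsSupported c g ∧ g u = u ∧
        ∀ h, Function.Involutive h → involutionWeight c h ≤ involutionWeight c g := by
      intro u
      obtain ⟨g, hg, hgm, hgu⟩ := hcase u
      obtain ⟨h, hh, hhs, hh0, hh1⟩ := exists_supported hc hg
      refine ⟨h, hh, hhs, hh0 u (by omega), fun h' hh' => (hgm h' hh').trans ?_⟩
      refine Finset.sum_le_sum fun v _ => ?_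
      rcases Nat.eq_zero_or_pos (c v (g v)) with hz | hz
      · rw [hz]; exact Nat.zero_le _
      · rw [hh1 v hz]
    obtain ⟨g, hg, hgw, hgmax⟩ := exists_max_missing_at_most_one hc hc0 hmiss W hcl hconn
    set c' : V → V → ℕ := fun a b => if a ∈ W then c a b - 1 else c a b with hc'
    have hle : ∀ a b, c' a b ≤ c a b := fun a b => by
      simp only [hc']; split_ifs <;> omega
    have hcs : ∀ a b, c' a b = c' b a := by
      intro a b
      simp only [hc', hc b a]
      by_cases ha : a ∈ W <;> by_cases hb : b ∈ W
      · simp [ha, hb]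
      · have : c a b = 0 := by
          by_contra h
          exact hb (hcl a ha b (Nat.pos_of_ne_zero h))
        simp [this]
      · have : c a b = 0 := by
          by_contra h
          exact ha (hcl b hb a (by rw [hc]; exact Nat.pos_of_ne_zero h))
        simp [this]
      · simp [ha, hb]
    have hcd : ∀ v, c' v v = 0 := fun v => by simp [hc', hc0]
    have ha₀ : a₀ ∈ W := by simp [hW, Relation.ReflTransGen.refl]
    obtain ⟨f', hf', hwt⟩ := ih _ (lt_sum c' hle a₀ b₀ (by simp [hc', ha₀]; omega)) c' hcs hcd rfl
    have h1 : involutionWeight c' f' + W.card ≤ involutionWeight c f + 1 :=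
      (Nat.add_le_add_right (hgmax f' hf') _).trans
        (hgw.trans (Nat.add_le_add_right (hfmax g hg trivial) _))
    have hsum : ∑ a, ∑ b, c a b * x a b
        ≤ ∑ a, ∑ b, c' a b * x a b + ∑ a ∈ W, ∑ b ∈ W, x a b := by
      have e : ∑ a ∈ W, ∑ b ∈ W, x a b
          = ∑ a, ∑ b, if a ∈ W then (if b ∈ W then x a b else 0) else 0 := by
        simp [Finset.sum_ite_mem]
      rw [e, ← Finset.sum_add_distrib]
      refine Finset.sum_le_sum fun a _ => ?_
      rw [← Finset.sum_add_distrib]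
      refine Finset.sum_le_sum fun b _ => ?_
      by_cases ha : a ∈ W
      · by_cases hb : b ∈ W
        · have h2 : (c a b : ℝ) ≤ c' a b + 1 := by
            have : c a b ≤ c' a b + 1 := by simp only [hc']; split_ifs; omega
            exact_mod_cast this
          have h3 := mul_le_mul_of_nonneg_right h2 (hx0 a b)
          simp only [ha, hb, if_true]
          linarith
        · have : c a b = 0 := by
            by_contra h
            exact hb (hcl a ha b (Nat.pos_of_ne_zero h))
          simp [this, hc', hb]
      · simp [hc', ha]
    -- For even `|W|` parity improves the drop to `|W|`, matching the summed degree inequalities;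
    -- for odd `|W|` the odd set inequality matches `|W| - 1`.
    rcases Nat.even_or_odd W.card with hev | hod
    · have h2 : ∑ a ∈ W, ∑ b ∈ W, x a b ≤ W.card := by
        rw [← nsmul_one W.card, ← Finset.sum_const]
        refine Finset.sum_le_sum fun a _ => le_trans ?_ (hdeg a)
        exact Finset.sum_le_univ_sum_of_nonneg fun b => hx0 a b
      obtain ⟨p, hp⟩ := even_involutionWeight hcs hcd hf'
      obtain ⟨q, hq⟩ := even_involutionWeight hc hc0 hf
      obtain ⟨r, hr⟩ := hev
      have h3 : (involutionWeight c' f' : ℝ) + W.card ≤ involutionWeight c f := by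
        exact_mod_cast (by omega : involutionWeight c' f' + W.card ≤ involutionWeight c f)
      linarith
    · have h2 := hodd W hod
      have h3 : (involutionWeight c' f' : ℝ) + W.card ≤ involutionWeight c f + 1 := by
        exact_mod_cast h1
      linarith

end OddSetInequalities
-- From certificates to signed measures on 0-1 points
section PseudoDistribution

variable {ι m : Type*} [Fintype ι] [DecidableEq ι]

/-- Möbius inversion on the upper sets of the lattice of finite sets. -/
theorem exists_sum_superset_eq (z : Finset ι → ℝ) :
    ∃ w : Finset ι → ℝ, (∀ N, ∑ M with N ⊆ M, w M = z N) ∧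
      ∀ N, (∀ M, N ⊆ M → z M = 0) → w N = 0 := by
  have wf : WellFounded fun M N : Finset ι => N < M := wellFounded_gt
  set w : Finset ι → ℝ := wf.fix fun N ih =>
    z N - ∑ M ∈ (Finset.univ.filter fun M : Finset ι => N < M).attach,
      ih M.1 (Finset.mem_filter.mp M.2).2 with hw
  have hrec : ∀ N, w N = z N - ∑ M with N < M, w M := by
    intro N
    rw [hw, wf.fix_eq, ← hw]
    rw [Finset.sum_attach _ w]
  refine ⟨w, fun N => ?_, fun N => ?_⟩
  · have : (Finset.univ.filter fun M : Finset ι => N ⊆ M)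
        = insert N (Finset.univ.filter fun M : Finset ι => N < M) := by
      ext M
      simp only [Finset.mem_filter, Finset.mem_univ, true_and, Finset.mem_insert]
      exact ⟨fun h => (eq_or_lt_of_le (show N ≤ M from h)).imp Eq.symm id,
        fun h => h.elim (fun e => e ▸ subset_rfl) fun h => h.le⟩
    rw [this, Finset.sum_insert (by simp), hrec N]
    ring
  · induction N using wf.induction with
    | _ N ih =>
    intro h
    rw [hrec, h N subset_rfl, Finset.sum_eq_zero, sub_zero]
    intro M hM
    have hNM := (Finset.mem_filter.mp hM).2
    exact ih M hNM fun K hK => h K (hNM.le.trans hK)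

omit [Fintype ι] [DecidableEq ι] in
theorem onOne_empty : onOne (∅ : Finset ι) = cube ι := by
  ext x
  simp [onOne]

omit [Fintype ι] in
theorem onOne_inter (S T : Finset ι) : onOne S ∩ onOne T = onOne (S ∪ T) := by
  ext x
  simp only [onOne, Set.mem_inter_iff, Set.mem_ofPred_eq, Finset.mem_union]
  exact ⟨fun h => ⟨h.1.1, fun i hi => hi.elim (h.1.2 i) (h.2.2 i)⟩,
    fun h => ⟨⟨h.1, fun i hi => h.2 i (Or.inl hi)⟩, h.1, fun i hi => h.2 i (Or.inr hi)⟩⟩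

omit [Fintype ι] [DecidableEq ι] in
theorem eq_one_of_mem_convexHull_onOne {S : Finset ι} {y : ι → ℝ}
    (hy : y ∈ convexHull ℝ (onOne S)) {i : ι} (hi : i ∈ S) : y i = 1 := by
  have hconv : Convex ℝ {y : ι → ℝ | y i = 1} := by
    intro u hu v hv s t _ _ hst
    have hu' : u i = 1 := hu
    have hv' : v i = 1 := hv
    show s * u i + t * v i = 1
    rw [hu', hv', mul_one, mul_one, hst]
  exact convexHull_min (fun u hu => hu.2 i hi) hconv hy

theorem onOne_mem_indexSet {A : Matrix m ι ℝ} {b : m → ℝ} {k : ℕ} {S : Finset ι}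
    (hS : IsTier A b k S) : onOne S ∈ indexSet A b k := by
  refine ⟨S, hS, Or.inl ⟨∅, Finset.empty_subset _, by simp, ?_⟩⟩
  ext x
  simp only [Finset.sdiff_empty, onOne, onZero, Set.mem_inter_iff, Set.mem_ofPred_eq]
  simp
  tauto

/-- A certificate matrix, restricted to the sets `N|₁` with `|N| ≤ L`, is the moment matrix of a
signed measure on the 0-1 points of the polytope, if every set of size at most `L` is a tier. -/
theorem exists_pseudoDistribution {A : Matrix m ι ℝ} {b : m → ℝ} {k L : ℕ} (hk : k ≠ 0)
    (hL : 1 ≤ L) (htier : ∀ S : Finset ι, S.card ≤ L → IsTier A b k S) {x : ι → ℝ}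
    (hx : x ∈ bzPlus A b k) :
    ∃ w : Finset ι → ℝ, (∀ M, (∀ y ∈ polytope A b, ∃ i ∈ M, y i ≠ 1) → w M = 0) ∧
      ∑ M, w M = 1 ∧ (∀ i, ∑ M with i ∈ M, w M = x i) ∧
      ∀ a : Finset ι → ℝ, 0 ≤ ∑ M, w M * (∑ N with N.card ≤ L, if N ⊆ M then a N else 0) ^ 2 := by
  classical
  rw [bzPlus, if_neg hk] at hx
  obtain ⟨Y, hY, hpsd, hYx⟩ := hx
  have hmem : ∀ N : Finset ι, N.card ≤ L → onOne N ∈ indexSet A b k := fun N hN =>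
    onOne_mem_indexSet (htier N hN)
  -- By consistency an entry depends only on the union of its two index sets. Sets that are no such
  -- union get the value zero: no square of degree-`L` polynomials sees them, and zero keeps the
  -- infeasible moments zero.
  set z : Finset ι → ℝ := fun N =>
    if h : ∃ q : Finset ι × Finset ι, q.1.card ≤ L ∧ q.2.card ≤ L ∧ q.1 ∪ q.2 = N
    then Y (onOne h.choose.1) (onOne h.choose.2) else 0 with hz
  have hzY : ∀ N₁ N₂ : Finset ι, N₁.card ≤ L → N₂.card ≤ L →
      z (N₁ ∪ N₂) = Y (onOne N₁) (onOne N₂) := by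
    intro N₁ N₂ h₁ h₂
    have h : ∃ q : Finset ι × Finset ι, q.1.card ≤ L ∧ q.2.card ≤ L ∧ q.1 ∪ q.2 = N₁ ∪ N₂ :=
      ⟨(N₁, N₂), h₁, h₂, rfl⟩
    have hs := h.choose_spec
    simp only [hz]
    rw [dif_pos h]
    refine hY.consistent _ (hmem _ hs.1) _ (hmem _ hs.2.1) _ (hmem _ h₁) _ (hmem _ h₂) ?_
    rw [onOne_inter, onOne_inter, hs.2.2]
  have hz0 : ∀ N, (∀ y ∈ polytope A b, ∃ i ∈ N, y i ≠ 1) → z N = 0 := by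
    intro N hN
    by_cases h : ∃ q : Finset ι × Finset ι, q.1.card ≤ L ∧ q.2.card ≤ L ∧ q.1 ∪ q.2 = N
    · obtain ⟨⟨N₁, N₂⟩, h₁, h₂, rfl⟩ := h
      rw [hzY N₁ N₂ h₁ h₂]
      refine hY.vanishing _ (hmem _ h₁) _ (hmem _ h₂) (Set.eq_empty_of_forall_notMem ?_)
      rintro y ⟨⟨hy1, hy2⟩, hyP⟩
      obtain ⟨i, hi, hne⟩ := hN y hyP
      rcases Finset.mem_union.mp hi with h | h
      · exact hne (eq_one_of_mem_convexHull_onOne hy1 h)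
      · exact hne (eq_one_of_mem_convexHull_onOne hy2 h)
    · simp only [hz]
      rw [dif_neg h]
  obtain ⟨w, hw, hw0⟩ := exists_sum_superset_eq z
  -- Every superset of an infeasible set is infeasible, so `z` vanishes above `M` and the inversion
  -- gives `M` weight zero.
  refine ⟨w, fun M hM => hw0 M fun N hN => hz0 N fun y hy => ?_, ?_, fun i => ?_, fun a => ?_⟩
  · obtain ⟨i, hi, h⟩ := hM y hy
    exact ⟨i, hN hi, h⟩
  · have h1 := hw ∅
    have h2 := hzY ∅ ∅ (by simp) (by simp)
    rw [Finset.empty_union, onOne_empty, hY.normalized] at h2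
    simpa [h2] using h1
  · have h1 := hw {i}
    have h2 := hzY {i} ∅ (by simpa using hL) (by simp)
    rw [Finset.union_empty, onOne_empty, hYx] at h2
    simpa [h2] using h1
  · have h1 := (hpsd.submatrix fun N : {N : Finset ι // N.card ≤ L} =>
      (⟨onOne N.1, hmem _ N.2⟩ : indexSet A b k)).dotProduct_mulVec_nonneg (fun N => a N.1)
    refine h1.trans_eq ?_
    have e1 : ∀ f : Finset ι → ℝ, ∑ N : {N : Finset ι // N.card ≤ L}, f N.1
        = ∑ N with N.card ≤ L, f N := fun f => (Finset.sum_subtype _ (by simp) f).symm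
    have e2 : (star fun N : {N : Finset ι // N.card ≤ L} => a N.1) ⬝ᵥ
        ((Matrix.of fun α β : indexSet A b k => Y α β).submatrix
          (fun N : {N : Finset ι // N.card ≤ L} => (⟨onOne N.1, hmem _ N.2⟩ : indexSet A b k))
          fun N : {N : Finset ι // N.card ≤ L} => (⟨onOne N.1, hmem _ N.2⟩ : indexSet A b k)).mulVec
          (fun N => a N.1)
        = ∑ N with N.card ≤ L, ∑ N' with N'.card ≤ L, a N * a N' * z (N ∪ N') := by
      rw [← e1]
      simp only [dotProduct, Matrix.mulVec, Matrix.submatrix_apply, Matrix.of_apply, Pi.star_apply,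
        star_trivial, Finset.mul_sum]
      refine Finset.sum_congr rfl fun N _ => ?_
      rw [← e1 fun N' => a N.1 * a N' * z (N.1 ∪ N')]
      refine Finset.sum_congr rfl fun N' _ => ?_
      rw [hzY N.1 N'.1 N.2 N'.2]
      ring
    rw [e2]
    have e3 : ∀ M, w M * (∑ N with N.card ≤ L, if N ⊆ M then a N else 0) ^ 2
        = ∑ N with N.card ≤ L, ∑ N' with N'.card ≤ L,
          w M * ((if N ⊆ M then a N else 0) * if N' ⊆ M then a N' else 0) := fun M => by
      rw [sq, Finset.sum_mul_sum, Finset.mul_sum]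
      exact Finset.sum_congr rfl fun N _ => Finset.mul_sum _ _ _
    rw [Finset.sum_congr rfl fun M _ => e3 M]
    symm
    rw [Finset.sum_comm]
    refine Finset.sum_congr rfl fun N _ => ?_
    rw [Finset.sum_comm]
    refine Finset.sum_congr rfl fun N' _ => ?_
    rw [← hw, Finset.mul_sum, Finset.sum_filter]
    refine Finset.sum_congr rfl fun M _ => ?_
    by_cases h : N ⊆ M <;> by_cases h' : N' ⊆ M <;>
      simp [Finset.union_subset_iff, h, h', mul_comm]

open Polynomial in
/-- If the 0-1 points of the polytope have at most `t` ones on `F`, and every set of at most `L`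
elements is a tier with `t < 2 L`, then `∑ i ∈ F, x i ≤ t` holds on the relaxation. -/
theorem sum_le_of_mem_bzPlus {A : Matrix m ι ℝ} {b : m → ℝ} {k L t : ℕ} (hk : k ≠ 0)
    (ht : t < 2 * L) (htier : ∀ S : Finset ι, S.card ≤ L → IsTier A b k S) {x : ι → ℝ}
    (hx : x ∈ bzPlus A b k) (F : Finset ι)
    (hF : ∀ M ⊆ F, (∃ y ∈ polytope A b, ∀ i ∈ M, y i = 1) → M.card ≤ t) :
    ∑ i ∈ F, x i ≤ t := by
  obtain ⟨w, hw0, hw1, hwx, hsq⟩ := exists_pseudoDistribution hk (by omega) htier hx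
  -- The expectation under the image of `w` by `M ↦ |M ∩ F|`.
  set E : ℝ[X] →ₗ[ℝ] ℝ := ∑ M : Finset ι, w M • leval ((M ∩ F).card : ℝ) with hE
  have hEp : ∀ p, E p = ∑ M, w M * p.eval ((M ∩ F).card : ℝ) := fun p => by
    simp [hE, LinearMap.sum_apply, leval]
  have hEsq : ∀ p : ℝ[X], p.natDegree ≤ L → 0 ≤ E (p ^ 2) := by
    intro p hp
    obtain ⟨c, hc⟩ := exists_eval_eq_sum_choose L p hp
    -- The binomial of `|M ∩ F|` over `i` counts the `i`-subsets of `F` contained in `M`, so the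
    -- binomial coefficients of `p` are the coefficients of these monomials.
    refine (hsq fun N => if N ⊆ F then c N.card else 0).trans_eq ?_
    rw [hEp]
    refine Finset.sum_congr rfl fun M _ => ?_
    rw [eval_pow, hc]
    congr 2
    have hmaps : ∀ N ∈ Finset.univ.filter fun N : Finset ι => N.card ≤ L,
        N.card ∈ Finset.range (L + 1) := fun N hN => by
      have := (Finset.mem_filter.mp hN).2
      exact Finset.mem_range.mpr (by omega)
    rw [← Finset.sum_fiberwise_of_maps_to hmaps]
    refine Finset.sum_congr rfl fun i hi => ?_
    have hi' := Finset.mem_range.mp hi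
    rw [mul_comm, ← Finset.card_powersetCard, ← nsmul_eq_mul, ← Finset.sum_const]
    simp only [← ite_and]
    rw [← Finset.sum_filter]
    refine Finset.sum_congr ?_ fun N hN => ?_
    · ext N
      simp only [Finset.mem_filter, Finset.mem_univ, true_and, Finset.mem_powersetCard,
        Finset.subset_inter_iff]
      constructor
      · rintro ⟨⟨-, h⟩, h'⟩; exact ⟨h', h⟩
      · rintro ⟨h', h⟩; exact ⟨⟨by omega, h⟩, h'⟩
    · rw [(Finset.mem_powersetCard.mp hN).2]
  -- The parameter `2 L - 1` is odd and gives degree `2 L`; the shift by `2 L - 1 - t` makes the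
  -- value at `j ≤ t` equal to `t - j`.
  have hdeg : ((gapPoly (2 * L - 1)).comp (X + C ((2 * L - 1 - t : ℕ) : ℝ))).natDegree ≤ 2 * L := by
    rw [natDegree_comp, natDegree_X_add_C, mul_one]
    exact (gapPoly_natDegree_le _).trans (by omega)
  have h := functional_nonneg_of_nonneg L E hEsq _ hdeg fun y => by
    rw [eval_comp]
    exact gapPoly_nonneg _ ⟨L - 1, by omega⟩ _
  rw [hEp] at h
  have hval : ∀ M, w M * ((gapPoly (2 * L - 1)).comp (X + C ((2 * L - 1 - t : ℕ) : ℝ))).eval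
      ((M ∩ F).card : ℝ) = w M * t - ∑ i ∈ F, if i ∈ M then w M else 0 := by
    intro M
    by_cases hM : w M = 0
    · simp [hM]
    have hle : (M ∩ F).card ≤ t := by
      have : ∃ y ∈ polytope A b, ∀ i ∈ M, y i = 1 := by
        by_contra! hcon
        exact hM (hw0 M hcon)
      obtain ⟨y, hy, hy1⟩ := this
      exact hF _ Finset.inter_subset_right
        ⟨y, hy, fun i hi => hy1 i (Finset.mem_inter.mp hi).1⟩
    have e : ((M ∩ F).card : ℝ) + ((2 * L - 1 - t : ℕ) : ℝ)
        = (((M ∩ F).card + (2 * L - 1 - t) : ℕ) : ℝ) := by push_cast; rfl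
    have e2 : (((2 * L - 1 : ℕ) : ℝ)) = t + ((2 * L - 1 - t : ℕ) : ℝ) := by
      rw [← Nat.cast_add]
      congr 1
      omega
    rw [eval_comp, eval_add, eval_X, eval_C, e, gapPoly_eval_nat _ _ (by omega),
      Finset.sum_ite_mem, Finset.sum_const, nsmul_eq_mul, Finset.inter_comm F M, e2]
    push_cast
    ring
  rw [Finset.sum_congr rfl fun M _ => hval M, Finset.sum_sub_distrib, ← Finset.sum_mul, hw1,
    Finset.sum_comm] at h
  simp only [← Finset.sum_filter, hwx] at h
  linarith

end PseudoDistribution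
-- The matching polytope of a graph
section MatchingPolytope

variable {V : Type*} [Fintype V] [DecidableEq V] {G : SimpleGraph V} [Fintype G.edgeSet]

open Classical in
/-- The symmetric function on pairs of vertices that is given by a function on the edges. -/
noncomputable def pairExtension {R : Type*} [Zero R] (h : G.edgeSet → R) (u v : V) : R :=
  if hh : G.Adj u v then h ⟨s(u, v), hh⟩ else 0

omit [Fintype V] [DecidableEq V] [Fintype G.edgeSet] in
theorem pairExtension_symm {R : Type*} [Zero R] (h : G.edgeSet → R) (u v : V) :
    pairExtension h u v = pairExtension h v u := by
  unfold pairExtension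
  by_cases hh : G.Adj u v
  · rw [dif_pos hh, dif_pos hh.symm]
    congr 2
    exact Sym2.eq_swap
  · rw [dif_neg hh, dif_neg fun e => hh e.symm]

omit [Fintype V] [DecidableEq V] [Fintype G.edgeSet] in
theorem pairExtension_self {R : Type*} [Zero R] (h : G.edgeSet → R) (v : V) :
    pairExtension h v v = 0 := dif_neg (G.irrefl)

theorem sum_pairExtension (h : G.edgeSet → ℝ) (u : V) :
    ∑ v, pairExtension h u v = ∑ e : G.edgeSet, if u ∈ (e : Sym2 V) then h e else 0 := by
  classical
  have e1 : ∑ v, pairExtension h u v = ∑ v with G.Adj u v, pairExtension h u v := by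
    rw [Finset.sum_filter]
    refine Finset.sum_congr rfl fun v _ => ?_
    by_cases hh : G.Adj u v <;> simp [hh, pairExtension]
  rw [e1, ← Finset.sum_filter]
  refine Finset.sum_bij (fun v hv => (⟨s(u, v), (Finset.mem_filter.mp hv).2⟩ : G.edgeSet))
    (fun v _ => by simp) (fun v _ w _ hvw => ?_) (fun e he => ?_) fun v hv => ?_
  · exact Sym2.congr_right.mp (Subtype.ext_iff.mp hvw)
  · obtain ⟨v, hv⟩ := (Finset.mem_filter.mp he).2
    have hadj : G.Adj u v := by
      rw [← SimpleGraph.mem_edgeSet, ← hv]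
      exact e.2
    exact ⟨v, by simpa using hadj, Subtype.ext hv.symm⟩
  · exact dif_pos (Finset.mem_filter.mp hv).2

omit [Fintype V] [Fintype G.edgeSet] in
theorem card_filter_mem_edge (W : Finset V) (e : G.edgeSet) (he : ∀ v ∈ (e : Sym2 V), v ∈ W) :
    (W.filter fun v => v ∈ (e : Sym2 V)).card = 2 := by
  obtain ⟨e, hadj⟩ := e
  induction e using Sym2.ind with
  | _ a b =>
    have hab : G.Adj a b := hadj
    have : (W.filter fun v => v ∈ s(a, b)) = {a, b} := by
      ext v
      simp only [Finset.mem_filter, Sym2.mem_iff, Finset.mem_insert, Finset.mem_singleton]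
      exact ⟨fun h => h.2, fun h => ⟨he v (Sym2.mem_iff.mpr h), h⟩⟩
    rw [this, Finset.card_pair hab.ne]

open Classical in
/-- The edges with both ends in `W`. -/
noncomputable def inducedEdges (G : SimpleGraph V) [Fintype G.edgeSet] (W : Finset V) :
    Finset G.edgeSet :=
  Finset.univ.filter fun e => ∀ v ∈ (e : Sym2 V), v ∈ W

theorem sum_incident_eq_two_mul (W : Finset V) (F : Finset G.edgeSet) (hF : F ⊆ inducedEdges G W)
    (h : G.edgeSet → ℝ) :
    ∑ u ∈ W, ∑ e ∈ F, (if u ∈ (e : Sym2 V) then h e else 0) = 2 * ∑ e ∈ F, h e := by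
  rw [Finset.sum_comm, Finset.mul_sum]
  refine Finset.sum_congr rfl fun e he => ?_
  rw [← Finset.sum_filter, Finset.sum_const,
    card_filter_mem_edge W e (Finset.mem_filter.mp (hF he)).2, nsmul_eq_mul]
  norm_num

theorem sum_sum_pairExtension (W : Finset V) (h : G.edgeSet → ℝ) :
    ∑ u ∈ W, ∑ v ∈ W, pairExtension h u v = 2 * ∑ e ∈ inducedEdges G W, h e := by
  classical
  rw [← sum_incident_eq_two_mul W _ subset_rfl]
  refine Finset.sum_congr rfl fun u hu => ?_
  have e1 := sum_pairExtension (fun e : G.edgeSet => if e ∈ inducedEdges G W then h e else 0) u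
  have e2 : ∑ v, pairExtension (fun e : G.edgeSet => if e ∈ inducedEdges G W then h e else 0) u v
      = ∑ v ∈ W, pairExtension h u v := by
    rw [← Finset.sum_filter_add_sum_filter_not Finset.univ (· ∈ W), Finset.filter_univ_mem,
      Finset.sum_eq_zero (s := Finset.univ.filter fun v => v ∉ W), add_zero]
    · refine Finset.sum_congr rfl fun v hv => ?_
      simp only [pairExtension, inducedEdges, Finset.mem_filter, Finset.mem_univ,
        Sym2.mem_iff, forall_eq_or_imp, forall_eq, hu, hv, and_self, if_true]
    · intro v hv
      have hv' := (Finset.mem_filter.mp hv).2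
      simp only [pairExtension, inducedEdges, Finset.mem_filter, Finset.mem_univ,
        Sym2.mem_iff, forall_eq_or_imp, forall_eq, hv', and_false, if_false]
      split_ifs <;> rfl
  rw [← e2, e1, ← Finset.sum_filter, ← Finset.sum_filter, ← Finset.sum_filter,
    Finset.filter_filter]
  refine Finset.sum_congr ?_ fun _ _ => rfl
  ext e
  simp [and_comm]

/-- Sum the degree inequalities over `W`; each edge of `M` is counted at both ends. -/
theorem card_le_of_mem_MT {W : Finset V} {y : G.edgeSet → ℝ} (hy : y ∈ MT G) {M : Finset G.edgeSet}
    (hM : M ⊆ inducedEdges G W) (h1 : ∀ e ∈ M, y e = 1) : 2 * M.card ≤ W.card := by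
  have e1 := sum_incident_eq_two_mul W M hM y
  rw [Finset.sum_congr rfl h1, Finset.sum_const, nsmul_one] at e1
  have e2 : ∑ u ∈ W, ∑ e ∈ M, (if u ∈ (e : Sym2 V) then y e else 0) ≤ ∑ u ∈ W, (1 : ℝ) := by
    refine Finset.sum_le_sum fun u _ => le_trans ?_ (hy.2 u)
    refine Finset.sum_le_univ_sum_of_nonneg fun e => ?_
    split_ifs
    exacts [(hy.1 e).1, le_rfl]
  rw [e1, Finset.sum_const, nsmul_one] at e2
  exact_mod_cast e2

open Classical in
/-- The characteristic vector of the matching of an involution. -/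
noncomputable def involutionVector (G : SimpleGraph V) (f : V → V) (e : G.edgeSet) : ℝ :=
  if ∃ v, (e : Sym2 V) = s(v, f v) then 1 else 0

omit [Fintype G.edgeSet] in
theorem pairExtension_involutionVector {f : V → V} (hf : Function.Involutive f) {u v : V}
    (h : G.Adj u v) : (involutionVector G f ⟨s(u, v), h⟩ = if v = f u then 1 else 0) := by
  classical
  unfold involutionVector
  congr 1
  simp only [eq_iff_iff, Sym2.eq_iff]
  constructor
  · rintro ⟨w, ⟨rfl, rfl⟩ | ⟨rfl, rfl⟩⟩
    · rfl
    · exact (hf v).symm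
  · rintro rfl
    exact ⟨u, Or.inl ⟨rfl, rfl⟩⟩

theorem involutionVector_mem {f : V → V} (hf : Function.Involutive f) :
    involutionVector G f ∈ MT G ∩ cube G.edgeSet := by
  classical
  refine ⟨⟨fun e => ?_, fun u => ?_⟩, fun e => ?_⟩
  · unfold involutionVector
    split_ifs <;> simp
  · rw [← sum_pairExtension]
    refine (Finset.sum_le_sum (g := fun v => if v = f u then (1 : ℝ) else 0) fun v _ => ?_).trans ?_
    · unfold pairExtension
      split_ifs with h h' h'
      · rw [pairExtension_involutionVector hf, if_pos h']
      · rw [pairExtension_involutionVector hf, if_neg h']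
      · exact zero_le_one
      · exact le_rfl
    · simp
  · unfold involutionVector
    split_ifs <;> simp

theorem inducedEdges_univ : inducedEdges G Finset.univ = Finset.univ := by
  ext e
  simp [inducedEdges]

theorem involutionWeight_pairExtension (c : G.edgeSet → ℕ) {f : V → V}
    (hf : Function.Involutive f) :
    (involutionWeight (pairExtension c) f : ℝ) = 2 * ∑ e, c e * involutionVector G f e := by
  classical
  rw [← inducedEdges_univ, ← sum_sum_pairExtension, involutionWeight, Nat.cast_sum]
  refine Finset.sum_congr rfl fun u _ => ?_
  rw [Finset.sum_eq_single (f u)]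
  · unfold pairExtension
    split_ifs with h
    · dsimp only
      rw [pairExtension_involutionVector hf h, if_pos rfl, mul_one]
    · simp
  · intro v _ hv
    unfold pairExtension
    split_ifs with h
    · dsimp only
      rw [pairExtension_involutionVector hf h, if_neg hv, mul_zero]
    · rfl
  · simp

theorem finite_cube (ι : Type*) [Finite ι] : (cube ι).Finite := by
  have : cube ι = Set.univ.pi fun _ => ({0, 1} : Set ℝ) := by
    ext x
    simp [cube]
  rw [this]
  exact Set.Finite.pi fun _ => Set.toFinite _

/-- The description of the matching polytope by the degree and the odd set inequalities. -/
theorem mem_integerHull_MT {x : G.edgeSet → ℝ} (hx : x ∈ MT G)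
    (hodd : ∀ W : Finset V, Odd W.card → 2 * ∑ e ∈ inducedEdges G W, x e ≤ W.card - 1) :
    x ∈ integerHull (MT G) := by
  classical
  by_contra hcon
  have hclosed : IsClosed (integerHull (MT G)) :=
    ((finite_cube G.edgeSet).subset Set.inter_subset_right).isClosed_convexHull ℝ
  -- A point outside the hull is separated by a real objective, whereas the weighted theorem needs
  -- natural weights. Scaling by `N` and rounding loses at most the number of edges, while the
  -- separation gap grows linearly in `N`.
  obtain ⟨φ, u, hφx, hφ⟩ :=
    geometric_hahn_banach_point_closed (convex_convexHull ℝ _) hclosed hcon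
  set c : G.edgeSet → ℝ := fun e => -φ (Pi.single e 1) with hc
  have hφc : ∀ y, φ y = -∑ e, c e * y e := by
    intro y
    conv_lhs => rw [pi_eq_sum_univ' y, map_sum]
    rw [← Finset.sum_neg_distrib]
    refine Finset.sum_congr rfl fun e _ => ?_
    rw [map_smul, smul_eq_mul]
    simp only [hc]
    ring
  have hpoint : ∀ y ∈ MT G ∩ cube G.edgeSet, ∑ e, c e * y e < -u := by
    intro y hy
    have := hφ y (subset_convexHull ℝ _ hy)
    rw [hφc] at this
    linarith
  have hbound : ∀ N : ℕ, N * (∑ e, c e * x e + u) ≤ Fintype.card G.edgeSet := by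
    intro N
    set C : G.edgeSet → ℕ := fun e => ⌊N * max (c e) 0⌋₊ with hC
    obtain ⟨f, hf, hw⟩ := exists_involution_weight_ge (x := pairExtension x)
      (pairExtension_symm x)
      (fun a b => by unfold pairExtension; split_ifs; exacts [(hx.1 _).1, le_rfl])
      (fun a => by rw [sum_pairExtension]; exact hx.2 a)
      (fun W hW => by rw [sum_sum_pairExtension]; exact hodd W hW)
      (pairExtension C) (pairExtension_symm C) (pairExtension_self C)
    rw [involutionWeight_pairExtension C hf] at hw
    have e1 : ∑ a, ∑ b, ((pairExtension C a b : ℕ) : ℝ) * pairExtension x a b = 2 * ∑ e, C e * x e := by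
      rw [← inducedEdges_univ, ← sum_sum_pairExtension]
      refine Finset.sum_congr rfl fun a _ => Finset.sum_congr rfl fun b _ => ?_
      unfold pairExtension
      split_ifs <;> simp
    rw [e1] at hw
    have hχ := involutionVector_mem (G := G) hf
    set χ := involutionVector G f with hχdef
    -- Rounding sees only positive coefficients; dropping the other edges from the matching leaves a
    -- matching.
    have hχ' : (fun e => if 0 < c e then χ e else 0) ∈ MT G ∩ cube G.edgeSet := by
      refine ⟨⟨fun e => ?_, fun v => (Finset.sum_le_sum fun e _ => ?_).trans (hχ.1.2 v)⟩,
        fun e => ?_⟩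
      · have := hχ.1.1 e
        dsimp only
        split_ifs
        · exact this
        · simp
      · have := (hχ.1.1 e).1
        dsimp only
        split_ifs <;> simp [this]
      · have := hχ.2 e
        dsimp only
        split_ifs
        · exact this
        · simp
    have h1 := hpoint _ hχ'
    have h2 : ∑ e, (C e : ℝ) * χ e ≤ N * ∑ e, c e * (if 0 < c e then χ e else 0) := by
      rw [Finset.mul_sum]
      refine Finset.sum_le_sum fun e _ => ?_
      have h3 : (C e : ℝ) ≤ N * max (c e) 0 := Nat.floor_le (by positivity)
      have h4 := mul_le_mul_of_nonneg_right h3 (hχ.1.1 e).1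
      refine h4.trans_eq ?_
      split_ifs with h
      · rw [max_eq_left h.le]; ring
      · rw [max_eq_right (not_lt.mp h)]; ring
    have h3 : N * ∑ e, c e * x e - Fintype.card G.edgeSet ≤ ∑ e, (C e : ℝ) * x e := by
      have : (Fintype.card G.edgeSet : ℝ) = ∑ e : G.edgeSet, (1 : ℝ) := by simp
      rw [Finset.mul_sum, this, ← Finset.sum_sub_distrib]
      refine Finset.sum_le_sum fun e _ => ?_
      have h4 : N * max (c e) 0 < C e + 1 := Nat.lt_floor_add_one _
      have h5 := mul_le_mul_of_nonneg_right h4.le (hx.1 e).1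
      have h6 : (N : ℝ) * (c e * x e) ≤ N * max (c e) 0 * x e := by
        rw [mul_assoc]
        exact mul_le_mul_of_nonneg_left
          (mul_le_mul_of_nonneg_right (le_max_left _ _) (hx.1 e).1) (Nat.cast_nonneg N)
      linarith [(hx.1 e).2]
    have h4 := mul_le_mul_of_nonneg_left h1.le (Nat.cast_nonneg (α := ℝ) N)
    linarith
  have hpos : 0 < ∑ e, c e * x e + u := by
    rw [hφc] at hφx
    linarith
  obtain ⟨N, hN⟩ := exists_nat_gt ((Fintype.card G.edgeSet : ℝ) / (∑ e, c e * x e + u))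
  rw [div_lt_iff₀ hpos] at hN
  exact absurd (hbound N) (not_le.mpr hN)

end MatchingPolytope

/-! ### Stars as obstructions, walls and tiers -/

section Tiers

variable {V : Type*} [Fintype V] [DecidableEq V] {G : SimpleGraph V} [Fintype G.edgeSet]

/-- The edges at a vertex. -/
def edgeStar (G : SimpleGraph V) [Fintype G.edgeSet] (v : V) : Finset G.edgeSet :=
  Finset.univ.filter fun e => v ∈ (e : Sym2 V)

omit [Fintype V] in
-- A star is the full support of its row, so it qualifies as a large obstruction for every `k`.
theorem isObstruction_edgeStar {k : ℕ} {v : V} (hv : 2 ≤ (edgeStar G v).card) :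
    IsObstruction (incidence G) (fun _ => 1) k (edgeStar G v) := by
  have hsupp : rowSupport (incidence G) v = edgeStar G v := by
    ext e
    simp [rowSupport, incidence, edgeStar]
  refine ⟨v, hsupp.ge, ?_, Or.inr (by rw [hsupp]; omega)⟩
  have : ∑ e ∈ edgeStar G v, incidence G v e = (edgeStar G v).card := by
    rw [← nsmul_one (edgeStar G v).card, ← Finset.sum_const]
    refine Finset.sum_congr rfl fun e he => ?_
    exact if_pos (Finset.mem_filter.mp he).2
  rw [this]
  show (1 : ℝ) < (edgeStar G v).card
  exact_mod_cast (show 1 < (edgeStar G v).card from hv)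

omit [Fintype V] in
-- Two distinct vertices share at most one edge.
theorem edgeStar_injective_of_two_le {u v : V} (hu : 2 ≤ (edgeStar G u).card) (huv : u ≠ v) : edgeStar G u ≠ edgeStar G v := by
  intro h
  obtain ⟨e, he, e', he', hne⟩ := Finset.one_lt_card.mp hu
  have key : ∀ e ∈ edgeStar G u, (e : Sym2 V) = s(u, v) := fun e he =>
    (Sym2.mem_and_mem_iff huv).mp ⟨(Finset.mem_filter.mp he).2, (Finset.mem_filter.mp (h.subset he)).2⟩
  exact hne (Subtype.ext ((key e he).trans (key e' he').symm))

/-- A set of at most `(k + 1) / 2` edges is contained in a wall. -/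
theorem exists_isWall_superset {k : ℕ} (hG : ∀ v, 2 ≤ (edgeStar G v).card) {T : Finset G.edgeSet}
    (hT : 2 * T.card ≤ k + 1) :
    ∃ W, IsWall (incidence G) (fun _ => 1) k W ∧ T ⊆ W := by
  classical
  -- The stars of all ends of `T`: at most two per edge, hence at most `k + 1`, and each edge of `T`
  -- lies in two different ones.
  set C : Finset (Finset G.edgeSet) :=
    (T.biUnion fun e => Finset.univ.filter fun v => v ∈ (e : Sym2 V)).image (edgeStar G) with hC
  refine ⟨Finset.univ.filter fun i => ∃ O ∈ C, ∃ O' ∈ C, O ≠ O' ∧ i ∈ O ∧ i ∈ O',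
    Or.inr ⟨C, ?_, fun O hO => ?_, fun i => by simp⟩, fun e he => ?_⟩
  · refine Finset.card_image_le.trans (Finset.card_biUnion_le.trans ?_)
    rw [Finset.sum_congr rfl fun e _ => card_filter_mem_edge Finset.univ e (by simp),
      Finset.sum_const, smul_eq_mul, mul_comm]
    exact hT
  · obtain ⟨v, -, rfl⟩ := Finset.mem_image.mp hO
    exact isObstruction_edgeStar (hG v)
  · have hmem : ∀ v ∈ (e : Sym2 V), edgeStar G v ∈ C := fun v hv =>
      Finset.mem_image_of_mem _ (Finset.mem_biUnion.mpr ⟨e, he, by simpa using hv⟩)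
    have hstar : ∀ v ∈ (e : Sym2 V), e ∈ edgeStar G v := fun v hv => by simpa [edgeStar] using hv
    rw [Finset.mem_filter]
    refine ⟨Finset.mem_univ _, ?_⟩
    obtain ⟨a, b, hab⟩ : ∃ a b, (e : Sym2 V) = s(a, b) := by
      induction h : (e : Sym2 V) using Sym2.ind with
      | _ a b => exact ⟨a, b, rfl⟩
    have hadj : G.Adj a b := by
      rw [← SimpleGraph.mem_edgeSet, ← hab]
      exact e.2
    have ha : a ∈ (e : Sym2 V) := by simp [hab]
    have hb : b ∈ (e : Sym2 V) := by simp [hab]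
    exact ⟨_, hmem a ha, _, hmem b hb, edgeStar_injective_of_two_le (hG a) hadj.ne, hstar a ha, hstar b hb⟩

/-- Enumerate `S` and cut it into `k` consecutive blocks of length at most `(k + 1) / 2`; each block
fits into a wall. -/
theorem isTier_of_card_le {k : ℕ} (hG : ∀ v, 2 ≤ (edgeStar G v).card) {S : Finset G.edgeSet}
    (hS : S.card ≤ k * ((k + 1) / 2)) : IsTier (incidence G) (fun _ => 1) k S := by
  classical
  set q := (k + 1) / 2 with hq
  set T : Fin k → Finset G.edgeSet := fun j =>
    S.filter fun e => ∃ h : e ∈ S, (S.equivFin ⟨e, h⟩ : ℕ) / q = j with hT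
  have hTcard : ∀ j, (T j).card ≤ q := by
    intro j
    rcases Nat.eq_zero_or_pos q with h0 | h0
    · have : S.card = 0 := by
        rw [h0, mul_zero] at hS
        omega
      exact (Finset.card_filter_le _ _).trans (by omega)
    rw [← Finset.card_range q]
    refine Finset.card_le_card_of_injOn
      (fun e => if h : e ∈ S then (S.equivFin ⟨e, h⟩ : ℕ) % q else 0) (fun e he => ?_) ?_
    · have heS := (Finset.mem_filter.mp he).1
      simp only [dif_pos heS, Finset.coe_range, Set.mem_Iio]
      exact Nat.mod_lt _ h0
    · intro e he e' he' h
      obtain ⟨heS, h1, h2⟩ := Finset.mem_filter.mp he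
      obtain ⟨heS', h1', h2'⟩ := Finset.mem_filter.mp he'
      simp only [dif_pos heS, dif_pos heS'] at h
      have : (S.equivFin ⟨e, heS⟩ : ℕ) = S.equivFin ⟨e', heS'⟩ := by
        rw [← Nat.div_add_mod (S.equivFin ⟨e, heS⟩ : ℕ) q,
          ← Nat.div_add_mod (S.equivFin ⟨e', heS'⟩ : ℕ) q, h, h2, h2']
      exact Subtype.ext_iff.mp (S.equivFin.injective (Fin.ext this))
  have hwall := fun j => exists_isWall_superset (k := k) hG (T := T j) (by
    have := hTcard j
    omega)
  choose W hW hTW using hwall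
  refine ⟨W, hW, fun e he => ?_⟩
  have hlt : (S.equivFin ⟨e, he⟩ : ℕ) / q < k := by
    rw [Nat.div_lt_iff_lt_mul]
    · exact (S.equivFin ⟨e, he⟩).2.trans_le hS
    · by_contra h0
      have : q = 0 := by omega
      rw [this, mul_zero] at hS
      have := Finset.card_pos.mpr ⟨e, he⟩
      omega
  exact ⟨⟨_, hlt⟩, hTW _ (Finset.mem_filter.mpr ⟨he, he, rfl⟩)⟩

/-- The relaxation of `MT(G)` is the matching polytope as soon as the level is large compared to
the number of vertices. -/
theorem bzPlus_incidence_eq {k t : ℕ} [DecidableEq G.edgeSet] (hG : ∀ v, 2 ≤ (edgeStar G v).card)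
    (hk : k ≠ 0) (hV : Fintype.card V ≤ 2 * t + 1) (ht : t < 2 * (k * ((k + 1) / 2))) :
    bzPlus (incidence G) (fun _ => 1) k = integerHull (polytope (incidence G) fun _ => 1) := by
  refine (integerHull_subset_bzPlus (fun v e => ?_) _ _).antisymm' fun x hx => ?_
  · unfold incidence
    split_ifs <;> simp
  have hxP : x ∈ MT G := by
    have hx' := hx
    rw [bzPlus, if_neg hk] at hx'
    obtain ⟨Y, hY, -, hYx⟩ := hx'
    have hcube : cube G.edgeSet ∈ indexSet (incidence G) (fun _ => 1) k := by
      rw [← onOne_empty]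
      exact onOne_mem_indexSet (isTier_of_card_le hG (by simp))
    -- The column of the whole cube is `(1, x)`, so the cone condition places `x` in the refinement
    -- and thus in the polytope.
    obtain ⟨s, -, y, hy, h⟩ := (hY.columns _ hcube).mem_cone
    rw [hY.normalized] at h
    have h1 : s = 1 := (congrArg Prod.fst h).symm
    have h2 : x = y := by
      have := congrArg Prod.snd h
      simp only [hYx, h1, one_smul] at this
      exact this
    rw [h2, ← polytope_incidence]
    exact hy.1
  rw [polytope_incidence]
  refine mem_integerHull_MT hxP fun W hW => ?_
  obtain ⟨r, hr⟩ := hW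
  have hWV := Finset.card_le_univ W
  have h := sum_le_of_mem_bzPlus (t := r) hk (by omega) (fun S hS => isTier_of_card_le hG hS) hx
    (inducedEdges G W) fun M hM ⟨y, hy, hy1⟩ => by
      rw [polytope_incidence] at hy
      have hc := card_le_of_mem_MT hy hM hy1
      omega
  rw [hr]
  push_cast
  linarith

end Tiers

/-! ### Complete graphs and the rank bound -/

theorem two_le_card_edgeStar_top {n : ℕ} (hn : n ≠ 0)
    [Fintype (⊤ : SimpleGraph (Fin (2 * n + 1))).edgeSet] (v : Fin (2 * n + 1)) :
    2 ≤ (edgeStar (⊤ : SimpleGraph (Fin (2 * n + 1))) v).card := by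
  have h1 : 1 < (Finset.univ.erase v).card := by
    rw [Finset.card_erase_of_mem (Finset.mem_univ v), Finset.card_univ, Fintype.card_fin]
    omega
  obtain ⟨a, ha, b, hb, hab⟩ := Finset.one_lt_card.mp h1
  have ha' := (Finset.mem_erase.mp ha).1
  have hb' := (Finset.mem_erase.mp hb).1
  refine Finset.one_lt_card.mpr ⟨⟨s(v, a), ha'.symm⟩, by simp [edgeStar], ⟨s(v, b), hb'.symm⟩,
    by simp [edgeStar], fun h => hab ?_⟩
  exact Sym2.congr_right.mp (Subtype.ext_iff.mp h)

end LiftProject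

theorem theorem14 (n : ℕ) :
    LiftProject.bzPlusRank
        (LiftProject.incidence (⊤ : SimpleGraph (Fin (2 * n + 1)))) (fun _ => (1 : ℝ))
      ≤ ((⌈Real.sqrt (2 * (n : ℝ) + 1 / 4) - 1 / 2⌉₊ : ℕ) : ℕ∞) := by
  set k := ⌈Real.sqrt (2 * (n : ℝ) + 1 / 4) - 1 / 2⌉₊ with hk
  refine iInf₂_le k ?_
  rcases Nat.eq_zero_or_pos n with rfl | hn
  -- Here the level is zero and there are no edges, so each point of the polytope is trivially a 0-1
  -- point.
  · have hk0 : k = 0 := by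
      rw [hk, Nat.ceil_eq_zero, sub_nonpos]
      refine Real.sqrt_le_iff.mpr ⟨by norm_num, by norm_num⟩
    have hE : IsEmpty (⊤ : SimpleGraph (Fin (2 * 0 + 1))).edgeSet := by
      constructor
      rintro ⟨e, he⟩
      induction e using Sym2.ind with
      | _ a b => exact he (Subsingleton.elim (α := Fin 1) a b)
    rw [hk0, LiftProject.bzPlus, if_pos rfl, LiftProject.integerHull]
    refine Set.Subset.antisymm (fun x hx => subset_convexHull ℝ _ ⟨hx, fun e => hE.elim e⟩)
      (convexHull_min Set.inter_subset_left (LiftProject.polytope_convex _ _))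
  -- Square `√(2 n + 1/4) ≤ k + 1/2`.
  · have hkk : 2 * n ≤ k * (k + 1) := by
      have h1 : Real.sqrt (2 * (n : ℝ) + 1 / 4) - 1 / 2 ≤ k := Nat.le_ceil _
      have h2 := Real.sq_sqrt (show (0 : ℝ) ≤ 2 * n + 1 / 4 by positivity)
      have h3 := Real.sqrt_nonneg (2 * (n : ℝ) + 1 / 4)
      have h4 : (2 * n : ℝ) ≤ k * (k + 1) := by nlinarith
      exact_mod_cast h4
    have hk0 : k ≠ 0 := by
      rintro h
      rw [h] at hkk
      omega
    refine LiftProject.bzPlus_incidence_eq (LiftProject.two_le_card_edgeStar_top hn.ne') hk0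
      (by rw [Fintype.card_fin]) ?_
    -- For `k ≥ 2`, `n ≤ k (k + 1) / 2 < k ^ 2 ≤ 2 L`. The strict step fails at `k = 1`, where
    -- directly `n ≤ 1 < 2 = 2 L`.
    rcases Nat.lt_or_ge k 2 with h | h
    · have : k = 1 := by omega
      rw [this] at hkk ⊢
      omega
    · have h1 : k ≤ 2 * ((k + 1) / 2) := by omega
      have h2 := Nat.mul_le_mul_left k h1
      nlinarith
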